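/- **QAOA energy on Erdős–Rényi MaxCut.** For real couplings $J=(J_{kl})_{\{k,l\}\subset[n]}$ let $H[J]=\sum_{\{k,l\}\subset[n]}J_{kl}Z_kZ_l$, an operator on $n$ qubits, and for $\boldsymbol\beta,\boldsymbol\gamma\in\mathbf R^p$ let $$|\Psi(J,\boldsymbol\beta,\boldsymbol\gamma)\rangle=e^{-i\frac{\beta_{p-1}}2\sum_kX_k}e^{-i\frac{\gamma_{p-1}}2H[J]}\cdots e^{-i\frac{\beta_0}2\sum_kX_k}e^{-i\frac{\gamma_0}2H[J]}|+\rangle^{\otimes n}$$ be the level-$p$ QAOA state, where $X_k,Z_k$ are the Pauli operators on qubit $k$. Write $J\sim\mathrm{ER}(n,q)$ if the $J_{kl}$ are i.i.d. Bernoulli$(q)$, and $J\sim\mathrm{SK}(n)$ if the $J_{kl}$ are i.i.d. $\mathcal N(0,1/n)$. Let $p\ge1$ be an integer and $\boldsymbol\beta^{SK},\boldsymbol\gamma^{SK}\in\mathbf R^p$. Then the limit $$E_{SK}:=\lim_{n\to\infty}\mathbf E_{J\sim\mathrm{SK}(n)}\Big\langle\Psi(J,\boldsymbol\beta^{SK},\boldsymbol\gamma^{SK})\Big|\frac{H[J]}{n}\Big|\Psi(J,\boldsymbol\beta^{SK},\boldsymbol\gamma^{SK})\Big\rangle$$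 exists, and for every integer $d\ge3$ so does the limit $$E_{ER}(d):=\lim_{n\to\infty}\mathbf E_{J\sim\mathrm{ER}(n,\frac d{n-1})}\Big\langle\Psi\Big(J,\boldsymbol\beta^{SK},\frac{\boldsymbol\gamma^{SK}}{\sqrt d}\Big)\Big|\frac{H[J]}{nd}\Big|\Psi\Big(J,\boldsymbol\beta^{SK},\frac{\boldsymbol\gamma^{SK}}{\sqrt d}\Big)\Big\rangle .$$ Moreover $$E_{ER}(d)=\frac1{\sqrt d}\,E_{SK}+\mathcal O\Big(\frac1d\Big),$$ that is, there is a constant $C$, depending only on $p,\boldsymbol\beta^{SK},\boldsymbol\gamma^{SK}$, with $|E_{ER}(d)-E_{SK}/\sqrt d|\le C/d$ for all integers $d\ge3$. -/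

import Mathlib

open MeasureTheory ProbabilityTheory Filter Topology
open scoped Matrix

noncomputable section

namespace QAOA

/-- Computational basis states of `n` qubits. -/
abbrev Bits (n : ℕ) : Type := Fin n → Bool

/-- Operators on `n` qubits, in the computational basis. -/
abbrev Op (n : ℕ) : Type := Matrix (Bits n) (Bits n) ℂ

/-- The unordered pairs `{k, l} ⊂ [n]`, each written once as `(k, l)` with `k < l`. -/
abbrev Pairs (n : ℕ) : Type := {e : Fin n × Fin n // e.1 < e.2}

/-- The Pauli operator `X` acting on qubit `k`. -/
def pauliX {n : ℕ} (k : Fin n) : Op n :=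
  Matrix.of fun x y => if x = Function.update y k (!(y k)) then 1 else 0

/-- The Pauli operator `Z` acting on qubit `k`. -/
def pauliZ {n : ℕ} (k : Fin n) : Op n :=
  Matrix.diagonal fun x => if x k then -1 else 1

/-- The mixer Hamiltonian `∑ₖ Xₖ`. -/
def mixer (n : ℕ) : Op n := ∑ k : Fin n, pauliX k

/-- The problem Hamiltonian `H[J] = ∑_{k < l} J_{kl} Zₖ Zₗ`. -/
def hamiltonian {n : ℕ} (J : Pairs n → ℝ) : Op n :=
  ∑ e : Pairs n, (J e : ℂ) • (pauliZ e.1.1 * pauliZ e.1.2)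

/-- The uniform superposition `|+⟩` on `n` qubits. -/
def plusState (n : ℕ) : Bits n → ℂ := fun _ => ((1 / Real.sqrt (2 ^ n) : ℝ) : ℂ)

/-- The QAOA state
`e^{-i β_{p-1} B / 2} e^{-i γ_{p-1} H / 2} ⋯ e^{-i β_0 B / 2} e^{-i γ_0 H / 2} |+⟩`,
where `B` is the mixer: the last pair of angles acts last. -/
def qaoaState {n : ℕ} (H : Op n) : (p : ℕ) → (Fin p → ℝ) → (Fin p → ℝ) → Bits n → ℂ
  | 0, _, _ => plusState n
  | p + 1, β, γ =>
      NormedSpace.exp ((-Complex.I * ((β (Fin.last p) / 2 : ℝ) : ℂ)) • mixer n) *ᵥ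
        (NormedSpace.exp ((-Complex.I * ((γ (Fin.last p) / 2 : ℝ) : ℂ)) • H) *ᵥ
          qaoaState H p (Fin.init β) (Fin.init γ))

/-- The QAOA energy `⟨Ψ(J, β, γ)| H[J] |Ψ(J, β, γ)⟩`. It is a real number because `H[J]` is
Hermitian (`im_energy_eq_zero` below), so that taking the real part loses nothing. -/
def energy {n p : ℕ} (J : Pairs n → ℝ) (β γ : Fin p → ℝ) : ℝ :=
  (star (qaoaState (hamiltonian J) p β γ) ⬝ᵥ
    (hamiltonian J *ᵥ qaoaState (hamiltonian J) p β γ)).re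

/-- `SK(n)`: independent couplings `J_{kl} ∼ n^{-1/2} 𝒩(0, 1)`, that is `𝒩(0, 1/n)`. -/
def skLaw (n : ℕ) : Measure (Pairs n → ℝ) :=
  Measure.pi fun _ => gaussianReal 0 ((n : NNReal)⁻¹)

/-- `ER(n, q)`: independent couplings `J_{kl} ∈ {0, 1}` with `J_{kl} = 1` with probability `q`.
For `q` outside `[0, 1]` the nearest point of `[0, 1]` is used. -/
def erLaw (n : ℕ) (q : ℝ) : Measure (Pairs n → ℝ) :=
  Measure.pi fun _ => bernoulliMeasure (1 : ℝ) 0 (Set.projIcc 0 1 zero_le_one q)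

lemma hamiltonian_isHermitian {n : ℕ} (J : Pairs n → ℝ) : (hamiltonian J).IsHermitian := by
  unfold hamiltonian pauliZ Matrix.IsHermitian
  simp only [Matrix.diagonal_mul_diagonal, Matrix.conjTranspose_sum, Matrix.conjTranspose_smul,
    Matrix.diagonal_conjTranspose]
  refine Finset.sum_congr rfl fun e _ => ?_
  congr 1
  · simp
  · congr 1
    funext x
    simp only [Pi.star_apply]
    split_ifs <;> simp

lemma im_energy_eq_zero {n p : ℕ} (J : Pairs n → ℝ) (β γ : Fin p → ℝ) :
    (star (qaoaState (hamiltonian J) p β γ) ⬝ᵥ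
      (hamiltonian J *ᵥ qaoaState (hamiltonian J) p β γ)).im = 0 :=
  (hamiltonian_isHermitian J).im_star_dotProduct_mulVec_self _

end QAOA

end

/-! The average energy is a sum over labellings of the `n` qubits by histories, a history recording
the bits of one qubit in the forward and in the backward evolution
(`star_dotProduct_hamiltonian_eq_sum`). Since the couplings are independent, the average factorizes
over pairs (`integral_energy_eq`): each pair carries the weight `w a b`, the characteristic function
of one coupling at a multiple of `phase γ a b`, and one marked pair carries a first moment instead.
All marked pairs contribute equally, so what remains is a mean-field partition function of `n - 2`
vertices in the environment of two fixed labels (`sum_marked_pair`), with `w = 1 + ψ / n + o(1 /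
n)`.

The amplitudes are complex and absolute values alone would give exponentially large bounds. The
cancellations come from causality. Rank a history by the last time at which its two evolutions
differ. Flipping both evolutions after that time reverses the sign of the amplitude, by unitarity of
the mixer (`histAmp_histBar`), and leaves the phase against every history of no larger rank
unchanged (`phase_histBar`). In a sum over the vertices of highest rank, each such vertex therefore
sees only the part of the fixed environment that is odd under the flip, which is `O(1 / n)`.
Choosing `m` such vertices costs about `n ^ m / m!`, so the sum over `m` is dominated by an
exponential series. Induction on the rank, starting from rank zero where labels do not interact and
the amplitudes form a probability distribution, gives `tendsto_partition`: the partition function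
tends to a product of factors `cavity`, one for each fixed label.

Both models thus have limits given by the same function `limitEnergy` of a pair `(ψ, h)`. Flipping
all bits of one history preserves its amplitude and negates the phase and the final spin, so only
the even part of `ψ` and the odd part of `h` count (`limitEnergy_even_odd`). For Erdős–Rényi
couplings, after multiplication by `√d`, these parts are `d (cos (φ / (2√d)) - 1)` and `-(i / 2) √d
sin (φ / (2√d))`, where `φ` is the phase. They are within `O(1 / d)` of the Sherrington–Kirkpatrick
values `-φ² / 8` and `-i φ / 4`, and `limitEnergy` is differentiable, so the energies are equally
close. -/

noncomputable section

namespace QAOA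

/-! ### Transfer operators -/

section TransferOperators

variable {A : Type*}

/-- The operator that adds one vertex with label in `S` to a system of vertices interacting
through the pair weight `w`: the argument `W` of a functional records the total weight that the
vertices already present assign to each label of a new one. -/
def addVertex (S : Finset A) (B : A → ℂ) (w : A → A → ℂ) : Module.End ℂ ((A → ℂ) → ℂ) where
  toFun G W := ∑ b ∈ S, B b * W b * G (fun c => W c * w b c)
  map_add' G G' := by
    funext W
    simp [mul_add, Finset.sum_add_distrib]
  map_smul' c G := by
    funext W
    simp only [Pi.smul_apply, smul_eq_mul, RingHom.id_apply, Finset.mul_sum]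
    exact Finset.sum_congr rfl fun b _ => by ring

lemma addVertex_apply (S : Finset A) (B : A → ℂ) (w : A → A → ℂ) (G : (A → ℂ) → ℂ) (W : A → ℂ) :
    addVertex S B w G W = ∑ b ∈ S, B b * W b * G (fun c => W c * w b c) := rfl

/-- With a symmetric weight the order in which vertices are added is immaterial. This is what
permits the binomial theorem in `partition_succ_rank`. -/
lemma commute_addVertex (S S' : Finset A) (B : A → ℂ) {w : A → A → ℂ} (hw : ∀ a b, w a b = w b a) :
    Commute (addVertex S B w) (addVertex S' B w) := by
  refine LinearMap.ext fun G => ?_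
  funext W
  simp only [Module.End.mul_apply, addVertex_apply, Finset.mul_sum]
  rw [Finset.sum_comm]
  refine Finset.sum_congr rfl fun b _ => Finset.sum_congr rfl fun c _ => ?_
  have : (fun x => W x * w c x * w b x) = fun x => W x * w b x * w c x := by
    funext x; ring
  rw [this, hw b c]
  ring

lemma addVertex_union [DecidableEq A] {S S' : Finset A} (h : Disjoint S S') (B : A → ℂ)
    (w : A → A → ℂ) : addVertex (S ∪ S') B w = addVertex S B w + addVertex S' B w := by
  refine LinearMap.ext fun G => ?_
  funext W
  simp [addVertex_apply, Finset.sum_union h]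

/-- The total weight that a list of labels assigns to the label of a further vertex. -/
def env (w : A → A → ℂ) (R : List A) (c : A) : ℂ := (R.map fun a => w a c).prod

@[simp] lemma env_nil (w : A → A → ℂ) (c : A) : env w [] c = 1 := rfl

@[simp] lemma env_cons (w : A → A → ℂ) (a : A) (R : List A) (c : A) :
    env w (a :: R) c = w a c * env w R c := by simp [env]

@[simp] lemma env_append (w : A → A → ℂ) (R R' : List A) (c : A) :
    env w (R ++ R') c = env w R c * env w R' c := by simp [env]

lemma env_mul_weight (w : A → A → ℂ) (a : A) (R : List A) :
    (fun c => env w R c * w a c) = env w (a :: R) := by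
  funext c; simp [mul_comm]

/-- At most `n` factors, each of norm at most `1 + C / n ≤ exp (C / n)`. -/
lemma norm_env_le {w : A → A → ℂ} {C : ℝ} {n : ℕ} (hn : 1 ≤ n) (hC : 0 ≤ C)
    (hw : ∀ a b, ‖w a b - 1‖ ≤ C / n) (L : List A) (hL : L.length ≤ n) (c : A) :
    ‖env w L c‖ ≤ Real.exp C := by
  have hn' : (0 : ℝ) < n := by exact_mod_cast hn
  have key : ‖env w L c‖ ≤ Real.exp (C / n) ^ L.length := by
    clear hL
    induction L with
    | nil => simp
    | cons a L ih =>
      rw [env_cons, norm_mul, List.length_cons, pow_succ']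
      refine mul_le_mul ?_ ih (norm_nonneg _) (Real.exp_nonneg _)
      calc ‖w a c‖ = ‖1 + (w a c - 1)‖ := by ring_nf
        _ ≤ ‖(1 : ℂ)‖ + ‖w a c - 1‖ := norm_add_le _ _
        _ ≤ C / n + 1 := by rw [norm_one]; linarith [hw a c]
        _ ≤ _ := Real.add_one_le_exp _
  refine key.trans ?_
  rw [← Real.exp_nat_mul]
  refine Real.exp_le_exp.2 ?_
  rw [mul_div_assoc', div_le_iff₀ hn', mul_comm]
  exact mul_le_mul_of_nonneg_left (by exact_mod_cast hL) hC

lemma norm_env_sub_one_le {w : A → A → ℂ} {C : ℝ} {n : ℕ} (hn : 1 ≤ n) (hC : 0 ≤ C)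
    (hw : ∀ a b, ‖w a b - 1‖ ≤ C / n) (L : List A) (hL : L.length ≤ n) (c : A) :
    ‖env w L c - 1‖ ≤ L.length * (C / n * Real.exp C) := by
  induction L with
  | nil => simp
  | cons a L ih =>
    have hL' : L.length ≤ n := by simp at hL; omega
    have e : env w (a :: L) c - 1 = (w a c - 1) * env w L c + (env w L c - 1) := by
      rw [env_cons]; ring
    rw [e]
    refine (norm_add_le _ _).trans ?_
    rw [norm_mul, List.length_cons, Nat.cast_succ, add_mul, one_mul, add_comm]
    refine add_le_add (ih hL') ?_
    exact mul_le_mul (hw a c) (norm_env_le hn hC hw L hL' c) (norm_nonneg _) (by positivity)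

lemma tendsto_weight {w : ℕ → A → A → ℂ} {ψ : A → A → ℂ}
    (hψ : ∀ a b, Tendsto (fun n : ℕ => (n : ℂ) * (w n a b - 1)) atTop (𝓝 (ψ a b))) (a b : A) :
    Tendsto (fun n => w n a b) atTop (𝓝 1) := by
  have h := (tendsto_inv_atTop_nhds_zero_nat (𝕜 := ℂ)).mul (hψ a b)
  rw [zero_mul] at h
  have h' := h.add_const 1
  rw [zero_add] at h'
  refine h'.congr' ?_
  filter_upwards [eventually_ge_atTop 1] with n hn
  have : (n : ℂ) ≠ 0 := by exact_mod_cast (by omega : n ≠ 0)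
  field_simp
  ring

lemma tendsto_env {w : ℕ → A → A → ℂ} {ψ : A → A → ℂ}
    (hψ : ∀ a b, Tendsto (fun n : ℕ => (n : ℂ) * (w n a b - 1)) atTop (𝓝 (ψ a b)))
    (L : List A) (c : A) : Tendsto (fun n => env (w n) L c) atTop (𝓝 1) := by
  induction L with
  | nil => simp
  | cons a L ih => simpa using (tendsto_weight hψ a c).mul ih

lemma tendsto_env_sub_one {w : ℕ → A → A → ℂ} {ψ : A → A → ℂ}
    (hψ : ∀ a b, Tendsto (fun n : ℕ => (n : ℂ) * (w n a b - 1)) atTop (𝓝 (ψ a b)))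
    (L : List A) (c : A) : Tendsto (fun n : ℕ => (n : ℂ) * (env (w n) L c - 1)) atTop
      (𝓝 (L.map fun a => ψ a c).sum) := by
  induction L with
  | nil => simp
  | cons a L ih =>
    have h := ((hψ a c).mul (tendsto_env hψ L c)).add ih
    rw [mul_one] at h
    simp only [List.map_cons, List.sum_cons, env_cons]
    refine h.congr fun n => ?_
    ring

lemma exp_sum_list_eq_prod (S : Finset A) (f : A → ℂ) (ψ : A → A → ℂ) (R : List A) :
    Complex.exp (∑ b ∈ S, f b * (R.map fun a => ψ a b).sum) =
      (R.map fun a => Complex.exp (∑ b ∈ S, f b * ψ a b)).prod := by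
  induction R with
  | nil => simp
  | cons a R ih =>
    simp only [List.map_cons, List.sum_cons, mul_add, Finset.sum_add_distrib, Complex.exp_add,
      List.prod_cons, ih]

end TransferOperators

/-! ### Causal systems -/

/-- A finite set of labels with complex amplitudes, ranked, and with an involution that changes
the sign of the amplitudes of positive rank. -/
structure CausalSystem (A : Type*) [Fintype A] where
  /-- the amplitude of a label -/
  amp : A → ℂ
  /-- the rank of a label -/
  rank : A → ℕ
  /-- the sign-reversing involution -/
  bar : A → A
  bar_bar : ∀ a, bar (bar a) = a
  rank_bar : ∀ a, rank (bar a) = rank a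
  amp_bar : ∀ a, rank a ≠ 0 → amp (bar a) = -amp a
  sum_amp : ∑ a with rank a = 0, amp a = 1
  sum_norm_amp : ∑ a with rank a = 0, ‖amp a‖ = 1

namespace CausalSystem

variable {A : Type*} [Fintype A] (𝒮 : CausalSystem A)

/-- The labels of rank `t`. -/
def level (t : ℕ) : Finset A := {a | 𝒮.rank a = t}

/-- The labels of rank at most `t`. -/
def below (t : ℕ) : Finset A := {a | 𝒮.rank a ≤ t}

@[simp] lemma mem_level {t : ℕ} {a : A} : a ∈ 𝒮.level t ↔ 𝒮.rank a = t := by simp [level]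

@[simp] lemma mem_below {t : ℕ} {a : A} : a ∈ 𝒮.below t ↔ 𝒮.rank a ≤ t := by simp [below]

lemma disjoint_level_below (t : ℕ) : Disjoint (𝒮.level (t + 1)) (𝒮.below t) := by
  rw [Finset.disjoint_left]
  intro a ha hb
  simp only [mem_level, mem_below] at ha hb
  omega

lemma below_succ [DecidableEq A] (t : ℕ) : 𝒮.below (t + 1) = 𝒮.level (t + 1) ∪ 𝒮.below t := by
  ext a
  simp only [mem_below, Finset.mem_union, mem_level]
  omega

lemma below_zero : 𝒮.below 0 = 𝒮.level 0 := by
  ext a; simp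

/-- A pair weight that respects the causal order: the involution at `a` is not seen by labels of
rank at most that of `a`, and labels of rank zero do not interact with each other. -/
structure IsCausal (w : A → A → ℂ) : Prop where
  symm : ∀ a b, w a b = w b a
  bar_left : ∀ a b, 𝒮.rank b ≤ 𝒮.rank a → w (𝒮.bar a) b = w a b
  eq_one : ∀ a b, 𝒮.rank a = 0 → 𝒮.rank b = 0 → w a b = 1

lemma sum_level_bar {M : Type*} [AddCommMonoid M] (t : ℕ) (f : A → M) :
    ∑ a ∈ 𝒮.level t, f (𝒮.bar a) = ∑ a ∈ 𝒮.level t, f a :=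
  Finset.sum_nbij' 𝒮.bar 𝒮.bar (by simp [𝒮.rank_bar]) (by simp [𝒮.rank_bar])
    (by simp [𝒮.bar_bar]) (by simp [𝒮.bar_bar]) (by simp)

/-- The partition function of `N` vertices with labels of rank at most `t` in an environment. -/
def partition (w : A → A → ℂ) (t N : ℕ) : (A → ℂ) → ℂ := (addVertex (𝒮.below t) 𝒮.amp w ^ N) 1

/-- As `partition`, with `m` further vertices of rank `t + 1`. -/
def partitionLevel (w : A → A → ℂ) (t N m : ℕ) : (A → ℂ) → ℂ :=
  (addVertex (𝒮.level (t + 1)) 𝒮.amp w ^ m) (𝒮.partition w t N)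

lemma partition_zero (w : A → A → ℂ) (t : ℕ) (W : A → ℂ) : 𝒮.partition w t 0 W = 1 := rfl

lemma partition_succ (w : A → A → ℂ) (t N : ℕ) (W : A → ℂ) : 𝒮.partition w t (N + 1) W =
    ∑ b ∈ 𝒮.below t, 𝒮.amp b * W b * 𝒮.partition w t N (fun c => W c * w b c) := by
  simp only [partition, pow_succ', Module.End.mul_apply, addVertex_apply]

@[simp] lemma partitionLevel_zero (w : A → A → ℂ) (t N : ℕ) :
    𝒮.partitionLevel w t N 0 = 𝒮.partition w t N := rfl

lemma partitionLevel_succ (w : A → A → ℂ) (t N m : ℕ) (W : A → ℂ) :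
    𝒮.partitionLevel w t N (m + 1) W = ∑ b ∈ 𝒮.level (t + 1),
      𝒮.amp b * W b * 𝒮.partitionLevel w t N m (fun c => W c * w b c) := by
  simp only [partitionLevel, pow_succ', Module.End.mul_apply, addVertex_apply]

/-- Binomial theorem for commuting operators: `m` counts the vertices of the top rank `t + 1`. -/
lemma partition_succ_rank {w : A → A → ℂ} (hw : ∀ a b, w a b = w b a) (t N : ℕ) (W : A → ℂ) :
    𝒮.partition w (t + 1) N W =
      ∑ m ∈ Finset.range (N + 1), (N.choose m : ℂ) * 𝒮.partitionLevel w t (N - m) m W := by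
  classical
  rw [partition, below_succ, addVertex_union (𝒮.disjoint_level_below t),
    (commute_addVertex _ _ _ hw).add_pow, LinearMap.sum_apply, Finset.sum_apply]
  refine Finset.sum_congr rfl fun m _ => ?_
  rw [← Nat.cast_comm, Module.End.mul_apply, Module.End.mul_apply, partitionLevel, partition]
  simp [← nsmul_eq_mul]

lemma partition_congr (w : A → A → ℂ) (t N : ℕ) {W W' : A → ℂ}
    (h : ∀ c, 𝒮.rank c ≤ t → W c = W' c) : 𝒮.partition w t N W = 𝒮.partition w t N W' := by
  induction N generalizing W W' with
  | zero => simp [partition_zero]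
  | succ N ih =>
    rw [partition_succ, partition_succ]
    refine Finset.sum_congr rfl fun b hb => ?_
    rw [h b (by simpa using hb), ih fun c hc => by rw [h c hc]]

lemma partitionLevel_congr (w : A → A → ℂ) (t N m : ℕ) {W W' : A → ℂ}
    (h : ∀ c, 𝒮.rank c ≤ t + 1 → W c = W' c) :
    𝒮.partitionLevel w t N m W = 𝒮.partitionLevel w t N m W' := by
  induction m generalizing W W' with
  | zero => exact 𝒮.partition_congr w t N fun c hc => h c (by omega)
  | succ m ih =>
    rw [partitionLevel_succ, partitionLevel_succ]
    refine Finset.sum_congr rfl fun b hb => ?_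
    rw [mem_level] at hb
    rw [h b hb.le, ih fun c hc => by rw [h c hc]]

/-- Labels of rank zero do not interact, so the vertices are independent. -/
lemma partition_rank_zero {w : A → A → ℂ} (hw : 𝒮.IsCausal w) (N : ℕ) (W : A → ℂ) :
    𝒮.partition w 0 N W = (∑ b ∈ 𝒮.level 0, 𝒮.amp b * W b) ^ N := by
  induction N generalizing W with
  | zero => simp [partition_zero]
  | succ N ih =>
    rw [partition_succ, pow_succ', ← ih, Finset.sum_mul, below_zero]
    refine Finset.sum_congr rfl fun b hb => ?_
    rw [mem_level] at hb
    rw [𝒮.partition_congr w 0 N fun c hc => by rw [hw.eq_one b c hb (by omega), mul_one]]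

/-- The involution cancels all but the part of the environment that it changes. -/
lemma partitionLevel_succ_env {w : A → A → ℂ} (hw : 𝒮.IsCausal w) (t N m : ℕ) (R L : List A)
    (hL : ∀ a ∈ L, 𝒮.rank a = t + 1) :
    𝒮.partitionLevel w t N (m + 1) (env w (L ++ R)) = ∑ b ∈ 𝒮.level (t + 1),
      𝒮.amp b * ((env w R b - env w R (𝒮.bar b)) / 2) * env w L b *
        𝒮.partitionLevel w t N m (env w (b :: L ++ R)) := by
  have hLbar : ∀ b, 𝒮.rank b = t + 1 → env w L (𝒮.bar b) = env w L b := by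
    intro b hb
    unfold env
    congr 1
    refine List.map_congr_left fun a ha => ?_
    rw [hw.symm, hw.bar_left b a (by rw [hL a ha, hb]), hw.symm]
  have hG : ∀ b, 𝒮.rank b = t + 1 → 𝒮.partitionLevel w t N m (env w (𝒮.bar b :: L ++ R)) =
      𝒮.partitionLevel w t N m (env w (b :: L ++ R)) := by
    intro b hb
    refine 𝒮.partitionLevel_congr w t N m fun c hc => ?_
    simp only [List.cons_append, env_cons]
    rw [hw.bar_left b c (by omega)]
  have h1 : 𝒮.partitionLevel w t N (m + 1) (env w (L ++ R)) = ∑ b ∈ 𝒮.level (t + 1),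
      𝒮.amp b * env w (L ++ R) b * 𝒮.partitionLevel w t N m (env w (b :: L ++ R)) := by
    rw [partitionLevel_succ]
    simp only [env_mul_weight, List.cons_append]
  -- Reindexing by `bar` reverses the amplitude; neither `L` nor the remaining vertices see the
  -- change, as their ranks are at most `t + 1`. Only `env w R` is altered, and averaging with `h1`
  -- leaves its odd part.
  have h2 : 𝒮.partitionLevel w t N (m + 1) (env w (L ++ R)) = ∑ b ∈ 𝒮.level (t + 1),
      -(𝒮.amp b * (env w L b * env w R (𝒮.bar b))) *
        𝒮.partitionLevel w t N m (env w (b :: L ++ R)) := by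
    rw [h1, ← 𝒮.sum_level_bar]
    refine Finset.sum_congr rfl fun b hb => ?_
    rw [mem_level] at hb
    rw [𝒮.amp_bar b (by omega), hG b hb, env_append, hLbar b hb]
    ring
  have h3 : 𝒮.partitionLevel w t N (m + 1) (env w (L ++ R)) =
      (𝒮.partitionLevel w t N (m + 1) (env w (L ++ R)) +
        𝒮.partitionLevel w t N (m + 1) (env w (L ++ R))) / 2 := by ring
  rw [h3]
  nth_rewrite 1 [h1]
  rw [h2, ← Finset.sum_add_distrib, Finset.sum_div]
  refine Finset.sum_congr rfl fun b _ => ?_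
  rw [env_append]
  ring

/-! ### The limit of many vertices -/

/-- The limiting weight of a label in the field of all vertices of rank at most `t`, when the pair
weight between `n` vertices is `1 + ψ / n` to first order. -/
def cavity (ψ : A → A → ℂ) : ℕ → A → ℂ
  | 0, a => Complex.exp (∑ b ∈ 𝒮.level 0, 𝒮.amp b * ψ a b)
  | t + 1, a => cavity ψ t a *
      Complex.exp (∑ b ∈ 𝒮.level (t + 1), 𝒮.amp b * cavity ψ t b * ψ a b)

/-- Up to level `t` only interactions of `a` with labels of rank at most `t ≤ rank a` enter, and
these do not see the involution. -/
lemma cavity_bar {ψ : A → A → ℂ} (hψ : ∀ a b, 𝒮.rank b ≤ 𝒮.rank a → ψ (𝒮.bar a) b = ψ a b)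
    (t : ℕ) (a : A) (ha : t ≤ 𝒮.rank a) : 𝒮.cavity ψ t (𝒮.bar a) = 𝒮.cavity ψ t a := by
  induction t with
  | zero =>
    simp only [cavity]
    congr 1
    refine Finset.sum_congr rfl fun b hb => ?_
    rw [mem_level] at hb
    rw [hψ a b (by omega)]
  | succ t ih =>
    simp only [cavity]
    rw [ih (by omega)]
    congr 2
    refine Finset.sum_congr rfl fun b hb => ?_
    rw [mem_level] at hb
    rw [hψ a b (by omega)]

/-- Each top-rank vertex gains a factor `O(R.length / n)` from the odd part of `env w R`. It then
joins the list `L` of placed top-rank labels, which produces no further odd part; this is why `L`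
and `R` are kept apart. -/
lemma norm_partitionLevel_le {w : A → A → ℂ} (hw : 𝒮.IsCausal w) {C D : ℝ} {n : ℕ} (hn : 1 ≤ n)
    (hC : 0 ≤ C) (hwC : ∀ a b, ‖w a b - 1‖ ≤ C / n) (t : ℕ)
    (hbound : ∀ N R, N + R.length = n → ‖𝒮.partition w t N (env w R)‖ ≤ D ^ R.length)
    (R : List A) (N m : ℕ) (L : List A) (hL : ∀ a ∈ L, 𝒮.rank a = t + 1)
    (hsum : N + (m + L.length + R.length) = n) :
    ‖𝒮.partitionLevel w t N m (env w (L ++ R))‖ ≤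
      ((∑ b ∈ 𝒮.level (t + 1), ‖𝒮.amp b‖) * (R.length * (C / n * Real.exp C)) * Real.exp C) ^ m *
        D ^ (m + L.length + R.length) := by
  induction m generalizing L with
  | zero =>
    simp only [partitionLevel_zero, pow_zero, one_mul, zero_add]
    have := hbound N (L ++ R) (by simp; omega)
    simpa using this
  | succ m ih =>
    rw [𝒮.partitionLevel_succ_env hw t N m R L hL]
    refine (norm_sum_le _ _).trans ?_
    set q := (∑ b ∈ 𝒮.level (t + 1), ‖𝒮.amp b‖) * (R.length * (C / n * Real.exp C)) * Real.exp C
      with hq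
    have hq0 : 0 ≤ q := by positivity
    have hbd : ∀ b ∈ 𝒮.level (t + 1), ‖𝒮.amp b * ((env w R b - env w R (𝒮.bar b)) / 2) *
        env w L b * 𝒮.partitionLevel w t N m (env w (b :: L ++ R))‖ ≤
        ‖𝒮.amp b‖ * (R.length * (C / n * Real.exp C)) * Real.exp C *
          (q ^ m * D ^ (m + 1 + L.length + R.length)) := by
      intro b hb
      rw [mem_level] at hb
      have i1 := ih (b :: L) (by simpa [hb] using hL) (by simp; omega)
      have i2 : ‖(env w R b - env w R (𝒮.bar b)) / 2‖ ≤ R.length * (C / n * Real.exp C) := by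
        have a1 := norm_env_sub_one_le hn hC hwC R (by omega) b
        have a2 := norm_env_sub_one_le hn hC hwC R (by omega) (𝒮.bar b)
        have e : (env w R b - env w R (𝒮.bar b)) / 2 =
          ((env w R b - 1) - (env w R (𝒮.bar b) - 1)) / 2 := by ring
        rw [e, norm_div, Complex.norm_two]
        linarith [norm_sub_le (env w R b - 1) (env w R (𝒮.bar b) - 1)]
      have i3 := norm_env_le hn hC hwC L (by omega) b
      rw [norm_mul, norm_mul, norm_mul]
      have e : m + (b :: L).length + R.length = m + 1 + L.length + R.length := by simp; omega
      rw [e] at i1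
      gcongr
    refine (Finset.sum_le_sum hbd).trans (le_of_eq ?_)
    rw [← Finset.sum_mul, ← Finset.sum_mul, ← Finset.sum_mul, ← hq, pow_succ']
    ring

/-- Here the amplitudes have total norm one, so the base of the power is `1 + O(R.length / n)` and
the power stays bounded. -/
lemma norm_partition_zero_le {w : A → A → ℂ} (hw : 𝒮.IsCausal w) {C : ℝ} {n : ℕ} (hn : 1 ≤ n)
    (hC : 0 ≤ C) (hwC : ∀ a b, ‖w a b - 1‖ ≤ C / n) (N : ℕ) (R : List A) (hNR : N + R.length = n) :
    ‖𝒮.partition w 0 N (env w R)‖ ≤ Real.exp (C * Real.exp C) ^ R.length := by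
  have hn' : (0 : ℝ) < n := by exact_mod_cast hn
  rw [𝒮.partition_rank_zero hw, norm_pow]
  set y := R.length * (C / n * Real.exp C) with hy
  have hy0 : 0 ≤ y := by positivity
  have h1 : ‖∑ b ∈ 𝒮.level 0, 𝒮.amp b * env w R b‖ ≤ Real.exp y := by
    have hb : ∀ b ∈ 𝒮.level 0, ‖𝒮.amp b * env w R b‖ ≤ ‖𝒮.amp b‖ * (y + 1) := by
      intro b _
      rw [norm_mul]
      refine mul_le_mul_of_nonneg_left ?_ (norm_nonneg _)
      have := norm_env_sub_one_le hn hC hwC R (by omega) b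
      calc ‖env w R b‖ = ‖(env w R b - 1) + 1‖ := by ring_nf
        _ ≤ ‖env w R b - 1‖ + ‖(1 : ℂ)‖ := norm_add_le _ _
        _ ≤ _ := by rw [norm_one]; linarith
    refine (norm_sum_le_of_le _ hb).trans ?_
    rw [← Finset.sum_mul, level, 𝒮.sum_norm_amp, one_mul]
    exact Real.add_one_le_exp y
  refine (pow_le_pow_left₀ (norm_nonneg _) h1 N).trans ?_
  rw [← Real.exp_nat_mul, ← Real.exp_nat_mul]
  refine Real.exp_le_exp.2 ?_
  have hN : (N : ℝ) / n ≤ 1 := by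
    rw [div_le_one hn']
    exact_mod_cast (by omega : N ≤ n)
  calc (N : ℝ) * y = (N : ℝ) / n * (R.length * (C * Real.exp C)) := by rw [hy]; ring
    _ ≤ 1 * (R.length * (C * Real.exp C)) := by gcongr
    _ = _ := one_mul _

lemma norm_choose_mul_partitionLevel_le {w : A → A → ℂ} (hw : 𝒮.IsCausal w) {C D : ℝ} {n : ℕ}
    (hn : 1 ≤ n) (hC : 0 ≤ C) (hD : 0 ≤ D) (hwC : ∀ a b, ‖w a b - 1‖ ≤ C / n) (t : ℕ)
    (hbound : ∀ N R, N + R.length = n → ‖𝒮.partition w t N (env w R)‖ ≤ D ^ R.length)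
    (R : List A) (hR : R.length ≤ n) (m : ℕ) :
    ‖((n - R.length).choose m : ℂ) * 𝒮.partitionLevel w t (n - R.length - m) m (env w R)‖ ≤
      D ^ R.length * ((R.length * ((∑ b ∈ 𝒮.level (t + 1), ‖𝒮.amp b‖) * (C * Real.exp C) *
        Real.exp C * D)) ^ m / m.factorial) := by
  have hn' : (0 : ℝ) < n := by exact_mod_cast hn
  set K := ∑ b ∈ 𝒮.level (t + 1), ‖𝒮.amp b‖
  have hK : 0 ≤ K := by positivity
  rcases lt_or_ge (n - R.length) m with hm | hm
  · rw [Nat.choose_eq_zero_of_lt hm]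
    simp only [Nat.cast_zero, zero_mul, norm_zero]
    positivity
  · have h1 := 𝒮.norm_partitionLevel_le hw hn hC hwC t hbound R (n - R.length - m) m []
      (by simp) (by simp; omega)
    -- The factor `n ^ m` from the choice of vertices cancels the `n ^ (-m)` gained by the
    -- involution.
    have h2 : ((n - R.length).choose m : ℝ) ≤ (n : ℝ) ^ m / m.factorial := by
      refine (Nat.choose_le_pow_div m _).trans ?_
      gcongr
      exact_mod_cast Nat.sub_le _ _
    rw [norm_mul, Complex.norm_natCast]
    simp only [List.nil_append, List.length_nil, add_zero] at h1
    refine (mul_le_mul h2 h1 (norm_nonneg _) (by positivity)).trans (le_of_eq ?_)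
    rw [pow_add, mul_pow, mul_pow, mul_pow, mul_pow, mul_pow, mul_pow, mul_pow, mul_pow, mul_pow,
      div_pow]
    field_simp
    ring

/-- The form `D ^ R.length` is stable under the induction: `m` vertices moved into the environment
cost `D ^ m`, which the series `∑ x ^ m / m!` absorbs, and its sum is again exponential in
`R.length`. -/
lemma exists_norm_partition_le {w : ℕ → A → A → ℂ} (hw : ∀ n, 𝒮.IsCausal (w n)) {C : ℝ}
    (hC : 0 ≤ C) (hwC : ∀ n a b, 1 ≤ n → ‖w n a b - 1‖ ≤ C / n) (t : ℕ) :
    ∃ D : ℝ, 0 ≤ D ∧ ∀ n, 1 ≤ n → ∀ N R, N + R.length = n →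
      ‖𝒮.partition (w n) t N (env (w n) R)‖ ≤ D ^ R.length := by
  induction t with
  | zero =>
    exact ⟨_, Real.exp_nonneg _, fun n hn N R h =>
      𝒮.norm_partition_zero_le (hw n) hn hC (fun a b => hwC n a b hn) N R h⟩
  | succ t ih =>
    obtain ⟨D, hD, hbound⟩ := ih
    refine ⟨D * Real.exp ((∑ b ∈ 𝒮.level (t + 1), ‖𝒮.amp b‖) * (C * Real.exp C) *
        Real.exp C * D), by positivity, fun n hn N R h => ?_⟩
    obtain rfl : N = n - R.length := by omega
    rw [𝒮.partition_succ_rank (hw n).symm]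
    refine (norm_sum_le_of_le _ fun m _ => 𝒮.norm_choose_mul_partitionLevel_le (hw n) hn hC hD
      (fun a b => hwC n a b hn) t (hbound n hn) R (by omega) m).trans ?_
    rw [← Finset.mul_sum, mul_pow, ← Real.exp_nat_mul]
    refine mul_le_mul_of_nonneg_left (Real.sum_le_exp_of_nonneg (by positivity) _) (by positivity)

/-- Each top-rank vertex contributes `n` times the odd part of its environment, which converges. The
placed labels `L` act on it with weight tending to `1`, so these vertices decouple from each other
and each only collects its own factor `cavity ψ t`. -/
lemma tendsto_partitionLevel {w : ℕ → A → A → ℂ} (hw : ∀ n, 𝒮.IsCausal (w n)) {ψ : A → A → ℂ}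
    (hψ : ∀ a b, Tendsto (fun n : ℕ => (n : ℂ) * (w n a b - 1)) atTop (𝓝 (ψ a b))) (t : ℕ)
    (hlim : ∀ R : List A, Tendsto (fun n => 𝒮.partition (w n) t (n - R.length) (env (w n) R)) atTop
      (𝓝 (R.map (𝒮.cavity ψ t)).prod)) (R : List A) (m : ℕ) (L : List A)
    (hL : ∀ a ∈ L, 𝒮.rank a = t + 1) :
    Tendsto (fun n : ℕ => (n : ℂ) ^ m *
      𝒮.partitionLevel (w n) t (n - (m + L.length + R.length)) m (env (w n) (L ++ R))) atTop
      (𝓝 ((∑ b ∈ 𝒮.level (t + 1), 𝒮.amp b * (((R.map fun a => ψ a b).sum -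
        (R.map fun a => ψ a (𝒮.bar b)).sum) / 2) * 𝒮.cavity ψ t b) ^ m *
        ((L ++ R).map (𝒮.cavity ψ t)).prod)) := by
  induction m generalizing L with
  | zero => simpa using hlim (L ++ R)
  | succ m ih =>
    have h : Tendsto (fun n : ℕ => ∑ b ∈ 𝒮.level (t + 1),
        𝒮.amp b * (((n : ℂ) * (env (w n) R b - 1) - (n : ℂ) * (env (w n) R (𝒮.bar b) - 1)) / 2) *
          env (w n) L b * ((n : ℂ) ^ m * 𝒮.partitionLevel (w n) t
            (n - (m + (b :: L).length + R.length)) m (env (w n) (b :: L ++ R)))) atTop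
        (𝓝 (∑ b ∈ 𝒮.level (t + 1), 𝒮.amp b * (((R.map fun a => ψ a b).sum -
        (R.map fun a => ψ a (𝒮.bar b)).sum) / 2) * 1 * ((∑ b ∈ 𝒮.level (t + 1), 𝒮.amp b *
          (((R.map fun a => ψ a b).sum - (R.map fun a => ψ a (𝒮.bar b)).sum) / 2) *
            𝒮.cavity ψ t b) ^ m * ((b :: L ++ R).map (𝒮.cavity ψ t)).prod))) := by
      refine tendsto_finsetSum _ fun b hb => ?_
      rw [mem_level] at hb
      refine Tendsto.mul (Tendsto.mul (Tendsto.mul tendsto_const_nhds ?_) (tendsto_env hψ L b))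
        (ih (b :: L) (by simpa [hb] using hL))
      exact ((tendsto_env_sub_one hψ R b).sub (tendsto_env_sub_one hψ R (𝒮.bar b))).div_const 2
    have e : ∀ n : ℕ, (∑ b ∈ 𝒮.level (t + 1),
        𝒮.amp b * (((n : ℂ) * (env (w n) R b - 1) - (n : ℂ) * (env (w n) R (𝒮.bar b) - 1)) / 2) *
          env (w n) L b * ((n : ℂ) ^ m * 𝒮.partitionLevel (w n) t
            (n - (m + (b :: L).length + R.length)) m (env (w n) (b :: L ++ R)))) =
        (n : ℂ) ^ (m + 1) * 𝒮.partitionLevel (w n) t (n - (m + 1 + L.length + R.length)) (m + 1)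
          (env (w n) (L ++ R)) := by
      intro n
      rw [𝒮.partitionLevel_succ_env (hw n) t _ m R L hL, Finset.mul_sum]
      refine Finset.sum_congr rfl fun b _ => ?_
      have e : m + (b :: L).length + R.length = m + 1 + L.length + R.length := by simp; omega
      rw [e]
      ring
    convert! h.congr e using 2
    simp only [List.cons_append, List.map_cons, List.prod_cons, mul_one]
    rw [pow_succ', mul_assoc, Finset.sum_mul]
    exact Finset.sum_congr rfl fun b _ => by ring

lemma tendsto_partition_zero {w : ℕ → A → A → ℂ} (hw : ∀ n, 𝒮.IsCausal (w n)) {ψ : A → A → ℂ}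
    (hψ : ∀ a b, Tendsto (fun n : ℕ => (n : ℂ) * (w n a b - 1)) atTop (𝓝 (ψ a b))) (R : List A) :
    Tendsto (fun n => 𝒮.partition (w n) 0 (n - R.length) (env (w n) R)) atTop
      (𝓝 (R.map (𝒮.cavity ψ 0)).prod) := by
  have h1 : Tendsto (fun n : ℕ => (n : ℂ) * ∑ b ∈ 𝒮.level 0, 𝒮.amp b * (env (w n) R b - 1)) atTop
      (𝓝 (∑ b ∈ 𝒮.level 0, 𝒮.amp b * (R.map fun a => ψ a b).sum)) := by
    have h : Tendsto (fun n : ℕ => ∑ b ∈ 𝒮.level 0, 𝒮.amp b * ((n : ℂ) * (env (w n) R b - 1)))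
        atTop (𝓝 (∑ b ∈ 𝒮.level 0, 𝒮.amp b * (R.map fun a => ψ a b).sum)) :=
      tendsto_finsetSum _ fun b _ => (tendsto_env_sub_one hψ R b).const_mul _
    refine h.congr fun n => ?_
    rw [Finset.mul_sum]
    exact Finset.sum_congr rfl fun b _ => by ring
  have e : ∀ n, ∑ b ∈ 𝒮.level 0, 𝒮.amp b * env (w n) R b =
      1 + ∑ b ∈ 𝒮.level 0, 𝒮.amp b * (env (w n) R b - 1) := by
    intro n
    have := 𝒮.sum_amp
    simp only [mul_sub, mul_one, Finset.sum_sub_distrib]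
    rw [level, this]
    ring
  have h2 : Tendsto (fun n => ∑ b ∈ 𝒮.level 0, 𝒮.amp b * env (w n) R b) atTop (𝓝 1) := by
    have h : Tendsto (fun n => ∑ b ∈ 𝒮.level 0, 𝒮.amp b * env (w n) R b) atTop
        (𝓝 (∑ b ∈ 𝒮.level 0, 𝒮.amp b * 1)) :=
      tendsto_finsetSum _ fun b _ => (tendsto_env hψ R b).const_mul _
    simp only [mul_one] at h
    rwa [level, 𝒮.sum_amp] at h
  -- The exponent is `n - R.length`; the missing fixed power of a base tending to `1` is divided
  -- out.
  have h3 := (Complex.tendsto_one_add_pow_exp_of_tendsto h1).div (h2.pow R.length) (by simp)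
  have hexp : Complex.exp (∑ b ∈ 𝒮.level 0, 𝒮.amp b * (R.map fun a => ψ a b).sum) =
      (R.map (𝒮.cavity ψ 0)).prod := by
    rw [exp_sum_list_eq_prod]
    rfl
  rw [one_pow, div_one, hexp] at h3
  refine h3.congr' ?_
  filter_upwards [eventually_ge_atTop R.length, h2.eventually_ne one_ne_zero] with n hn hne
  rw [𝒮.partition_rank_zero (hw n), Pi.div_apply, ← e, div_eq_iff (pow_ne_zero _ hne), ← pow_add,
    Nat.sub_add_cancel hn]

lemma tendsto_choose_div_pow (r m : ℕ) :
    Tendsto (fun n : ℕ => ((n - r).choose m : ℝ) / (n : ℝ) ^ m) atTop (𝓝 (1 / m.factorial)) := by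
  have h1 : Tendsto (fun n : ℕ => ((n + r : ℕ) : ℝ) * (1 / ((n + r : ℕ) : ℝ))) atTop (𝓝 1) := by
    refine tendsto_const_nhds.congr' ?_
    filter_upwards [eventually_ge_atTop 1] with n hn
    have : ((n + r : ℕ) : ℝ) ≠ 0 := by exact_mod_cast (by omega : n + r ≠ 0)
    field_simp
  have h2 : Tendsto (fun n : ℕ => (n : ℝ) * (1 / ((n + r : ℕ) : ℝ))) atTop (𝓝 1) := by
    have h0 : Tendsto (fun n : ℕ => (r : ℝ) * (1 / ((n + r : ℕ) : ℝ))) atTop (𝓝 (r * 0)) :=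
      ((tendsto_one_div_atTop_nhds_zero_nat (𝕜 := ℝ)).comp (tendsto_add_atTop_nat r)).const_mul _
    have := h1.sub h0
    simp only [mul_zero, sub_zero] at this
    refine this.congr fun n => ?_
    push_cast
    ring
  have h3 := tendsto_choose_mul_pow_atTop m h2
  rw [← tendsto_add_atTop_iff_nat r]
  simp only [Nat.add_sub_cancel]
  convert! h3 using 2
  · rw [one_div, inv_pow, div_eq_mul_inv]
  · simp

/-- The partition function of all vertices but finitely many factorizes over these in the limit. -/
theorem tendsto_partition {w : ℕ → A → A → ℂ} (hw : ∀ n, 𝒮.IsCausal (w n)) {ψ : A → A → ℂ}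
    (hψ : ∀ a b, Tendsto (fun n : ℕ => (n : ℂ) * (w n a b - 1)) atTop (𝓝 (ψ a b))) (t : ℕ)
    (R : List A) : Tendsto (fun n => 𝒮.partition (w n) t (n - R.length) (env (w n) R)) atTop
      (𝓝 (R.map (𝒮.cavity ψ t)).prod) := by
  -- Convergent sequences are bounded; summing the bounds over the finitely many pairs of labels
  -- makes `C` uniform.
  obtain ⟨C, hC, hwC⟩ : ∃ C : ℝ, 0 ≤ C ∧ ∀ n a b, 1 ≤ n → ‖w n a b - 1‖ ≤ C / n := by
    choose c hc using fun a b => (hψ a b).norm.bddAbove_range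
    refine ⟨∑ a, ∑ b, |c a b|, by positivity, fun n a b hn => ?_⟩
    have hn' : (0 : ℝ) < n := by exact_mod_cast hn
    rw [le_div_iff₀ hn', mul_comm]
    have h1 : (n : ℝ) * ‖w n a b - 1‖ ≤ c a b := by
      have := hc a b (Set.mem_range_self n)
      simpa using this
    refine h1.trans ((le_abs_self _).trans ?_)
    refine (Finset.single_le_sum (f := fun b => |c a b|) (fun _ _ => abs_nonneg _)
      (Finset.mem_univ b)).trans ?_
    exact Finset.single_le_sum (f := fun a => ∑ b, |c a b|)
      (fun _ _ => Finset.sum_nonneg fun _ _ => abs_nonneg _) (Finset.mem_univ a)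
  induction t generalizing R with
  | zero => exact 𝒮.tendsto_partition_zero hw hψ R
  | succ t ih =>
    obtain ⟨D, hD, hbound⟩ := 𝒮.exists_norm_partition_le hw hC hwC t
    have hψbar : ∀ a b, 𝒮.rank b ≤ 𝒮.rank a → ψ (𝒮.bar a) b = ψ a b := fun a b hab =>
      tendsto_nhds_unique ((hψ (𝒮.bar a) b).congr fun n => by rw [(hw n).bar_left a b hab])
        (hψ a b)
    set x := ∑ b ∈ 𝒮.level (t + 1), 𝒮.amp b * (((R.map fun a => ψ a b).sum -
        (R.map fun a => ψ a (𝒮.bar b)).sum) / 2) * 𝒮.cavity ψ t b with hx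
    have hterm : ∀ m, Tendsto (fun n : ℕ => ((n - R.length).choose m : ℂ) *
        𝒮.partitionLevel (w n) t (n - R.length - m) m (env (w n) R)) atTop
        (𝓝 (x ^ m / m.factorial * (R.map (𝒮.cavity ψ t)).prod)) := by
      intro m
      have h1 : Tendsto (fun n : ℕ => ((((n - R.length).choose m : ℝ) / (n : ℝ) ^ m : ℝ) : ℂ))
          atTop (𝓝 ((1 / m.factorial : ℝ) : ℂ)) :=
        (Complex.continuous_ofReal.tendsto _).comp (tendsto_choose_div_pow R.length m)
      have h2 := h1.mul (𝒮.tendsto_partitionLevel hw hψ t ih R m [] (by simp))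
      rw [← hx] at h2
      have e : x ^ m / m.factorial * (R.map (𝒮.cavity ψ t)).prod = ((1 / m.factorial : ℝ) : ℂ) *
          (x ^ m * (([] ++ R).map (𝒮.cavity ψ t)).prod) := by
        push_cast
        rw [List.nil_append]
        ring
      rw [e]
      refine h2.congr' ?_
      filter_upwards [eventually_ge_atTop 1] with n hn
      have hn' : (n : ℂ) ≠ 0 := by exact_mod_cast (by omega : n ≠ 0)
      have e2 : n - (m + ([] : List A).length + R.length) = n - R.length - m := by simp; omega
      rw [e2, List.nil_append]
      push_cast
      field_simp
    -- The bound on a single term does not depend on `n` and is summable over `m`.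
    have hdom := tendsto_tsum_of_dominated_convergence (𝓕 := atTop)
      (bound := fun m : ℕ => D ^ R.length * ((R.length * ((∑ b ∈ 𝒮.level (t + 1), ‖𝒮.amp b‖) *
        (C * Real.exp C) * Real.exp C * D)) ^ m / m.factorial))
      ((Real.summable_pow_div_factorial _).mul_left _) hterm (by
        filter_upwards [eventually_ge_atTop 1, eventually_ge_atTop R.length] with n hn hR m
        exact 𝒮.norm_choose_mul_partitionLevel_le (hw n) hn hC hD (fun a b => hwC n a b hn) t
          (hbound n hn) R hR m)
    have hlhs : ∀ n, ∑' m, ((n - R.length).choose m : ℂ) *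
        𝒮.partitionLevel (w n) t (n - R.length - m) m (env (w n) R) =
        𝒮.partition (w n) (t + 1) (n - R.length) (env (w n) R) := by
      intro n
      rw [𝒮.partition_succ_rank (hw n).symm]
      refine tsum_eq_sum fun m hm => ?_
      rw [Finset.mem_range] at hm
      rw [Nat.choose_eq_zero_of_lt (by omega)]
      simp
    -- The antisymmetrization is now undone: at rank `t + 1` the amplitude is odd and the cavity
    -- factor even under `bar`, so both halves of the difference contribute equally.
    have hxx : x =
        ∑ b ∈ 𝒮.level (t + 1), 𝒮.amp b * 𝒮.cavity ψ t b * (R.map fun a => ψ a b).sum := by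
      have hbar : ∑ b ∈ 𝒮.level (t + 1), 𝒮.amp b * (R.map fun a => ψ a (𝒮.bar b)).sum *
          𝒮.cavity ψ t b = -∑ b ∈ 𝒮.level (t + 1), 𝒮.amp b * (R.map fun a => ψ a b).sum *
          𝒮.cavity ψ t b := by
        rw [← 𝒮.sum_level_bar, ← Finset.sum_neg_distrib]
        refine Finset.sum_congr rfl fun b hb => ?_
        rw [mem_level] at hb
        rw [𝒮.amp_bar b (by omega), 𝒮.bar_bar, 𝒮.cavity_bar hψbar t b (by omega)]
        ring
      have hsplit : x = (∑ b ∈ 𝒮.level (t + 1), 𝒮.amp b * (R.map fun a => ψ a b).sum *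
          𝒮.cavity ψ t b - ∑ b ∈ 𝒮.level (t + 1), 𝒮.amp b *
          (R.map fun a => ψ a (𝒮.bar b)).sum * 𝒮.cavity ψ t b) / 2 := by
        rw [hx, ← Finset.sum_sub_distrib, Finset.sum_div]
        exact Finset.sum_congr rfl fun b _ => by ring
      rw [hsplit, hbar, sub_neg_eq_add, add_self_div_two]
      exact Finset.sum_congr rfl fun b _ => by ring
    have hrhs : ∑' m : ℕ, x ^ m / m.factorial * (R.map (𝒮.cavity ψ t)).prod =
        (R.map (𝒮.cavity ψ (t + 1))).prod := by
      have hexp : ∑' m : ℕ, x ^ m / m.factorial = Complex.exp x := by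
        rw [Complex.exp_eq_exp_ℂ, NormedSpace.exp_eq_tsum_div]
      rw [tsum_mul_right, hexp, hxx, exp_sum_list_eq_prod, ← List.prod_map_mul]
      simp only [cavity, mul_comm]
    rw [hrhs] at hdom
    exact hdom.congr hlhs

end CausalSystem

/-! ### Products over pairs -/

section PairProducts

variable {M : Type*} [CommMonoid M]

lemma prod_pairs_eq_prod_ite {n : ℕ} (F : Fin n → Fin n → M) :
    ∏ e : Pairs n, F e.1.1 e.1.2 = ∏ i, ∏ j, if i < j then F i j else 1 := by
  rw [← Finset.prod_product', ← Finset.prod_filter]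
  exact (Finset.prod_subtype _ (by simp) fun e : Fin n × Fin n => F e.1 e.2).symm

lemma prod_pairs_succ {n : ℕ} (F : Fin (n + 1) → Fin (n + 1) → M) :
    ∏ e : Pairs (n + 1), F e.1.1 e.1.2 =
      (∏ j : Fin n, F 0 j.succ) * ∏ e : Pairs n, F e.1.1.succ e.1.2.succ := by
  rw [prod_pairs_eq_prod_ite, prod_pairs_eq_prod_ite fun i j => F i.succ j.succ]
  simp [Fin.prod_univ_succ]

/-- A permutation of `[n]` acts on the unordered pairs. -/
def permPairs {n : ℕ} (σ : Equiv.Perm (Fin n)) : Equiv.Perm (Pairs n) where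
  toFun e := if h : σ e.1.1 < σ e.1.2 then ⟨(σ e.1.1, σ e.1.2), h⟩ else
    ⟨(σ e.1.2, σ e.1.1), lt_of_le_of_ne (not_lt.1 h) fun h' => e.2.ne' (σ.injective h')⟩
  invFun e := if h : σ.symm e.1.1 < σ.symm e.1.2 then ⟨(σ.symm e.1.1, σ.symm e.1.2), h⟩ else
    ⟨(σ.symm e.1.2, σ.symm e.1.1),
      lt_of_le_of_ne (not_lt.1 h) fun h' => e.2.ne' (σ.symm.injective h')⟩
  left_inv := by
    rintro ⟨⟨i, j⟩, h⟩
    have h' : ¬ j < i := not_lt.2 (le_of_lt h)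
    dsimp only at h ⊢
    by_cases hσ : σ i < σ j <;> simp [hσ, h, h']
  right_inv := by
    rintro ⟨⟨i, j⟩, h⟩
    have h' : ¬ j < i := not_lt.2 (le_of_lt h)
    dsimp only at h ⊢
    by_cases hσ : σ.symm i < σ.symm j <;> simp [hσ, h, h']

lemma prod_pairs_perm {n : ℕ} (σ : Equiv.Perm (Fin n)) (F : Fin n → Fin n → M)
    (hF : ∀ i j, F i j = F j i) :
    ∏ e : Pairs n, F (σ e.1.1) (σ e.1.2) = ∏ e : Pairs n, F e.1.1 e.1.2 := by
  refine Fintype.prod_equiv (permPairs σ) _ _ ?_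
  rintro ⟨⟨i, j⟩, h⟩
  by_cases hσ : σ i < σ j
  · simp [permPairs, hσ]
  · simp [permPairs, hσ, hF (σ i) (σ j)]

end PairProducts

/-! ### Sums over labelled vertices -/

section LabelSums

variable {A : Type*} [Fintype A]

lemma sum_fin_succ_fun {M : Type*} [AddCommMonoid M] {N : ℕ} (f : (Fin (N + 1) → A) → M) :
    ∑ a, f a = ∑ b, ∑ a, f (Fin.cons b a) := by
  rw [← (Fin.consEquiv fun _ : Fin (N + 1) => A).sum_comp f, Fintype.sum_prod_type]
  rfl

lemma addVertex_pow_apply (B : A → ℂ) (w : A → A → ℂ) (N : ℕ) (W : A → ℂ) :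
    (addVertex Finset.univ B w ^ N) 1 W =
      ∑ a : Fin N → A, (∏ i, B (a i) * W (a i)) * ∏ e : Pairs N, w (a e.1.1) (a e.1.2) := by
  induction N generalizing W with
  | zero => simp
  | succ N ih =>
    rw [sum_fin_succ_fun, pow_succ', Module.End.mul_apply, addVertex_apply]
    refine Finset.sum_congr rfl fun b _ => ?_
    rw [ih, Finset.mul_sum]
    refine Finset.sum_congr rfl fun a _ => ?_
    rw [prod_pairs_succ fun i j => w ((Fin.cons b a : Fin (N + 1) → A) i)
      ((Fin.cons b a : Fin (N + 1) → A) j), Fin.prod_univ_succ]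
    simp only [Fin.cons_zero, Fin.cons_succ, Finset.prod_mul_distrib]
    ring

/-- A sum over all labellings with one marked pair, in terms of the transfer operator. -/
lemma sum_marked_pair (B : A → ℂ) {w g : A → A → ℂ} (hw : ∀ a b, w a b = w b a)
    (hg : ∀ a b, g a b = g b a) {m : ℕ} (e₀ : Pairs (m + 2)) :
    ∑ a : Fin (m + 2) → A, (∏ i, B (a i)) *
        ∏ e : Pairs (m + 2), (if e = e₀ then g (a e.1.1) (a e.1.2) else w (a e.1.1) (a e.1.2)) =
      ∑ a, ∑ b, B a * B b * g a b * (addVertex Finset.univ B w ^ m) 1 (env w [a, b]) := by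
  obtain ⟨σ, hσ0, hσ1⟩ : ∃ σ : Equiv.Perm (Fin (m + 2)), σ 0 = e₀.1.1 ∧ σ 1 = e₀.1.2 := by
    -- The second swap sends `0` to `e₀.1.1`. The first must send `1` to the preimage of `e₀.1.2`
    -- under it, and fixes `0` because that preimage is not `0`.
    refine ⟨(Equiv.swap 1 (Equiv.swap 0 e₀.1.1 e₀.1.2)).trans (Equiv.swap 0 e₀.1.1), ?_, ?_⟩
    · have h : Equiv.swap 0 e₀.1.1 e₀.1.2 ≠ 0 := by
        rw [Ne, Equiv.swap_apply_eq_iff, Equiv.swap_apply_left]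
        exact e₀.2.ne'
      rw [Equiv.trans_apply, Equiv.swap_apply_of_ne_of_ne (by simp) h.symm, Equiv.swap_apply_left]
    · simp
  -- Pairs are compared as unordered ones because `σ` need not preserve the order of the two
  -- vertices.
  have hpair : ∀ e : Pairs (m + 2), e = e₀ ↔ s(e.1.1, e.1.2) = s(e₀.1.1, e₀.1.2) := by
    rintro ⟨⟨i, j⟩, h⟩
    obtain ⟨⟨k, l⟩, h'⟩ := e₀
    dsimp only at h h'
    simp only [Subtype.mk.injEq, Prod.mk.injEq, Sym2.eq_iff]
    refine ⟨Or.inl, fun h0 => h0.resolve_right ?_⟩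
    rintro ⟨rfl, rfl⟩
    exact absurd h h'.not_gt
  have h1 : ∀ a : Fin (m + 2) → A,
      ∏ e : Pairs (m + 2), (if e = e₀ then g (a e.1.1) (a e.1.2) else w (a e.1.1) (a e.1.2)) =
      ∏ e : Pairs (m + 2), (if s(e.1.1, e.1.2) = s(0, 1) then g (a (σ e.1.1)) (a (σ e.1.2))
        else w (a (σ e.1.1)) (a (σ e.1.2))) := by
    intro a
    simp only [hpair]
    rw [← prod_pairs_perm σ fun i j => if s(i, j) = s(e₀.1.1, e₀.1.2) then g (a i) (a j)
      else w (a i) (a j)]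
    · refine Finset.prod_congr rfl fun e _ => ?_
      have : s(σ e.1.1, σ e.1.2) = s(e₀.1.1, e₀.1.2) ↔ s(e.1.1, e.1.2) = s(0, 1) := by
        rw [← hσ0, ← hσ1]
        simp only [Sym2.eq_iff, EmbeddingLike.apply_eq_iff_eq]
      simp only [this]
    · intro i j
      rw [Sym2.eq_swap, hg, hw]
  have h2 : ∑ a : Fin (m + 2) → A, (∏ i, B (a i)) *
        ∏ e : Pairs (m + 2), (if e = e₀ then g (a e.1.1) (a e.1.2) else w (a e.1.1) (a e.1.2)) =
      ∑ a : Fin (m + 2) → A, (∏ i, B (a i)) *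
        ∏ e : Pairs (m + 2), (if s(e.1.1, e.1.2) = s(0, 1) then g (a e.1.1) (a e.1.2)
          else w (a e.1.1) (a e.1.2)) := by
    refine Fintype.sum_equiv (Equiv.arrowCongr σ.symm (Equiv.refl A)) _ _ fun a => ?_
    rw [h1]
    simp only [Equiv.arrowCongr_apply, Equiv.coe_refl, Function.comp_apply, id_eq,
      Equiv.symm_symm]
    rw [Equiv.prod_comp σ fun i => B (a i)]
  rw [h2, sum_fin_succ_fun]
  refine Finset.sum_congr rfl fun a _ => ?_
  rw [sum_fin_succ_fun]
  refine Finset.sum_congr rfl fun b _ => ?_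
  rw [addVertex_pow_apply, Finset.mul_sum]
  refine Finset.sum_congr rfl fun c _ => ?_
  set f : Fin (m + 2) → A := Fin.cons a (Fin.cons b c) with hf
  have f0 : f 0 = a := rfl
  have f1 : f 1 = b := rfl
  have f2 : ∀ i : Fin m, f i.succ.succ = c i := fun _ => rfl
  rw [prod_pairs_succ fun i j => if s(i, j) = s(0, 1) then g (f i) (f j) else w (f i) (f j),
    prod_pairs_succ fun i j : Fin (m + 1) => if s(i.succ, j.succ) = s(0, 1)
      then g (f i.succ) (f j.succ) else w (f i.succ) (f j.succ),
    Fin.prod_univ_succ, Fin.prod_univ_succ, Fin.prod_univ_succ]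
  have hne : ∀ i : Fin m, (i.succ.succ : Fin (m + 2)) ≠ 1 := fun i h =>
    Fin.succ_ne_zero i (Fin.succ_injective _ h)
  simp [f0, f1, f2, hne, Finset.prod_mul_distrib]
  ring

end LabelSums

/-! ### The path sum of the QAOA energy -/

/-- The eigenvalue of the Pauli operator `Z` at a computational basis state. -/
def spin (b : Bool) : ℝ := if b then -1 else 1

@[simp] lemma spin_not (b : Bool) : spin (!b) = -spin b := by cases b <;> simp [spin]

/-- The matrix elements of `e^{-i β X / 2}`. -/
def mixAmp (β : ℝ) (x y : Bool) : ℂ :=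
  if x = y then Complex.cos (β / 2) else -Complex.I * Complex.sin (β / 2)

/-! ### Diagonalization of the mixer -/

/-- The unnormalized Hadamard transform. -/
def hadamard (n : ℕ) : Op n :=
  Matrix.of fun x y => ∏ k, if x k && y k then (-1 : ℂ) else 1

lemma hadamard_apply {n : ℕ} (x y : Bits n) :
    hadamard n x y = ∏ k, if x k && y k then (-1 : ℂ) else 1 := rfl

lemma sum_prod_bits {n : ℕ} (f : Fin n → Bool → ℂ) :
    ∑ y : Bits n, ∏ k, f k (y k) = ∏ k, (f k true + f k false) := by
  have h := Finset.prod_univ_sum (fun _ : Fin n => (Finset.univ : Finset Bool)) f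
  rw [Fintype.piFinset_univ] at h
  rw [← h]
  simp

lemma hadamard_mul_self (n : ℕ) : hadamard n * hadamard n = (2 : ℂ) ^ n • (1 : Op n) := by
  ext x z
  rw [Matrix.mul_apply]
  simp only [hadamard_apply, ← Finset.prod_mul_distrib]
  rw [sum_prod_bits fun k b => (if x k && b then (-1 : ℂ) else 1) * if b && z k then (-1) else 1]
  have h : ∀ k, (((if x k && true then (-1 : ℂ) else 1) * if true && z k then (-1) else 1) +
      (if x k && false then (-1 : ℂ) else 1) * if false && z k then (-1) else 1) =
      if x k = z k then 2 else 0 := by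
    intro k
    cases x k <;> cases z k <;> norm_num
  simp only [h]
  rw [Finset.prod_ite_zero]
  simp [Matrix.one_apply, funext_iff]

/-- The columns of the Hadamard transform are joint eigenvectors of all `pauliX k`. -/
lemma hadamard_update {n : ℕ} (x y : Bits n) (k : Fin n) :
    hadamard n (Function.update x k (!(x k))) y = spin (y k) * hadamard n x y := by
  rw [hadamard_apply, hadamard_apply, ← Finset.mul_prod_erase _ _ (Finset.mem_univ k),
    ← Finset.mul_prod_erase _ _ (Finset.mem_univ k), ← mul_assoc]
  congr 1
  · rw [Function.update_self]
    cases x k <;> cases y k <;> simp [spin]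
  · refine Finset.prod_congr rfl fun l hl => ?_
    rw [Function.update_of_ne (Finset.ne_of_mem_erase hl)]

lemma pauliX_mul_apply {n : ℕ} (k : Fin n) (M : Op n) (x z : Bits n) :
    (pauliX k * M) x z = M (Function.update x k (!(x k))) z := by
  rw [Matrix.mul_apply, Finset.sum_eq_single (Function.update x k (!(x k)))]
  · simp [pauliX]
  · intro y _ hy
    have : x ≠ Function.update y k (!(y k)) := by
      rintro rfl
      exact hy (by simp)
    simp [pauliX, this]
  · simp

lemma mixer_mul_hadamard (n : ℕ) : mixer n * hadamard n =
    hadamard n * Matrix.diagonal fun y => ∑ k, (spin (y k) : ℂ) := by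
  ext x y
  rw [mixer, Finset.sum_mul, Matrix.sum_apply, Matrix.mul_diagonal, Finset.mul_sum]
  refine Finset.sum_congr rfl fun k _ => ?_
  rw [pauliX_mul_apply, hadamard_update, mul_comm]

lemma isUnit_hadamard (n : ℕ) : IsUnit (hadamard n) := by
  refine IsUnit.of_mul_eq_one (((2 : ℂ) ^ n)⁻¹ • hadamard n) ?_
  rw [Matrix.mul_smul, hadamard_mul_self, smul_smul, inv_mul_cancel₀ (by simp), one_smul]

lemma hadamard_inv (n : ℕ) : (hadamard n)⁻¹ = ((2 : ℂ) ^ n)⁻¹ • hadamard n := by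
  refine Matrix.inv_eq_right_inv ?_
  rw [Matrix.mul_smul, hadamard_mul_self, smul_smul, inv_mul_cancel₀ (by simp), one_smul]

/-- In the Hadamard basis the exponential is diagonal with entries that factorize over the qubits,
so the sum over the intermediate basis state factorizes as well. -/
lemma exp_smul_mixer (n : ℕ) (β : ℝ) (x z : Bits n) :
    NormedSpace.exp ((-Complex.I * ((β / 2 : ℝ) : ℂ)) • mixer n) x z =
      ∏ k, mixAmp β (x k) (z k) := by
  set θ : ℂ := -Complex.I * ((β / 2 : ℝ) : ℂ) with hθ
  have h1 : θ • mixer n = hadamard n *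
      (Matrix.diagonal fun y => ∑ k, θ * (spin (y k) : ℂ)) * (hadamard n)⁻¹ := by
    have hd : (Matrix.diagonal fun y : Bits n => ∑ k, θ * (spin (y k) : ℂ)) =
        θ • Matrix.diagonal fun y => ∑ k, (spin (y k) : ℂ) := by
      rw [← Matrix.diagonal_smul]
      congr 1
      funext y
      simp [Finset.mul_sum]
    rw [hd, Matrix.mul_smul, ← mixer_mul_hadamard, Matrix.smul_mul, Matrix.mul_assoc,
      Matrix.mul_nonsing_inv _ ((Matrix.isUnit_iff_isUnit_det _).1 (isUnit_hadamard n)),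
      Matrix.mul_one]
  rw [h1, Matrix.exp_conj _ _ (isUnit_hadamard n), Matrix.exp_diagonal, hadamard_inv,
    Matrix.mul_smul, Matrix.smul_apply, Matrix.mul_apply]
  have h2 : ∀ y : Bits n, (hadamard n * Matrix.diagonal
      (NormedSpace.exp fun y : Bits n => ∑ k, θ * (spin (y k) : ℂ))) x y * hadamard n y z =
      ∏ k, ((if x k && y k then (-1 : ℂ) else 1) * Complex.exp (θ * spin (y k)) *
        if y k && z k then (-1 : ℂ) else 1) := by
    intro y
    rw [Matrix.mul_diagonal, Pi.coe_exp, ← Complex.exp_eq_exp_ℂ, Complex.exp_sum, hadamard_apply,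
      hadamard_apply, Finset.prod_mul_distrib, Finset.prod_mul_distrib]
  simp only [h2]
  rw [sum_prod_bits fun k b => (if x k && b then (-1 : ℂ) else 1) * Complex.exp (θ * spin b) *
        if b && z k then (-1 : ℂ) else 1, smul_eq_mul, ← inv_pow]
  have h3 : ((2 : ℂ)⁻¹) ^ n = ∏ _k : Fin n, (2 : ℂ)⁻¹ := by simp
  rw [h3, ← Finset.prod_mul_distrib]
  refine Finset.prod_congr rfl fun k _ => ?_
  have hc : Complex.cos (β / 2) = (Complex.exp (-θ) + Complex.exp θ) / 2 := by
    rw [Complex.cos, hθ]; push_cast; ring_nf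
  have hs : -Complex.I * Complex.sin (β / 2) = (Complex.exp θ - Complex.exp (-θ)) / 2 := by
    rw [Complex.sin, hθ]; push_cast; ring_nf; rw [Complex.I_sq]; ring
  unfold mixAmp
  rw [hc, hs]
  cases x k <;> cases z k <;> simp [spin] <;> ring

/-- The diagonal entries of the problem Hamiltonian. -/
def cost {n : ℕ} (J : Pairs n → ℝ) (x : Bits n) : ℝ :=
  ∑ e : Pairs n, J e * (spin (x e.1.1) * spin (x e.1.2))

lemma hamiltonian_eq_diagonal {n : ℕ} (J : Pairs n → ℝ) :
    hamiltonian J = Matrix.diagonal fun x => (cost J x : ℂ) := by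
  ext x y
  simp only [hamiltonian, pauliZ, Matrix.diagonal_mul_diagonal, Matrix.sum_apply,
    Matrix.smul_apply, Matrix.diagonal_apply, cost]
  split_ifs with h
  · push_cast
    refine Finset.sum_congr rfl fun e _ => ?_
    rw [smul_eq_mul]
    congr 1
    cases x e.1.1 <;> cases x e.1.2 <;> simp [spin]
  · simp

/-! ### Expansion of state and energy over paths -/

/-- The amplitude of a path of basis states. -/
def pathAmp {n p : ℕ} (β : Fin p → ℝ) (γ : Fin p → ℝ) (c : Bits n → ℝ) (v : Fin (p + 1) → Bits n) :
    ℂ := ((1 / Real.sqrt (2 ^ n) : ℝ) : ℂ) * ∏ j : Fin p,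
      ((∏ k, mixAmp (β j) (v j.succ k) (v j.castSucc k)) *
        Complex.exp (-Complex.I * ((γ j / 2 : ℝ) : ℂ) * c (v j.castSucc)))

lemma qaoaState_eq_sum {n : ℕ} (c : Bits n → ℝ) (p : ℕ) (β γ : Fin p → ℝ) (x : Bits n) :
    qaoaState (Matrix.diagonal fun x => (c x : ℂ)) p β γ x =
      ∑ v : Fin (p + 1) → Bits n, if v (Fin.last p) = x then pathAmp β γ c v else 0 := by
  induction p generalizing x with
  | zero =>
    rw [← (Equiv.funUnique (Fin 1) (Bits n)).symm.sum_comp]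
    simp [qaoaState, plusState, pathAmp]
  | succ p ih =>
    have hd : NormedSpace.exp ((-Complex.I * ((γ (Fin.last p) / 2 : ℝ) : ℂ)) •
        Matrix.diagonal fun x => (c x : ℂ)) = Matrix.diagonal fun x =>
          Complex.exp (-Complex.I * ((γ (Fin.last p) / 2 : ℝ) : ℂ) * c x) := by
      rw [← Matrix.diagonal_smul, Matrix.exp_diagonal]
      congr 1
      funext y
      rw [Pi.coe_exp, ← Complex.exp_eq_exp_ℂ]
      simp
    rw [qaoaState, hd, ← (Fin.snocEquiv fun _ : Fin (p + 2) => Bits n).sum_comp,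
      Fintype.sum_prod_type, Finset.sum_comm]
    have hr : ∀ v : Fin (p + 1) → Bits n, ∑ y : Bits n,
        (if (Fin.snocEquiv fun _ : Fin (p + 2) => Bits n) (y, v) (Fin.last (p + 1)) = x then
          pathAmp β γ c ((Fin.snocEquiv fun _ : Fin (p + 2) => Bits n) (y, v)) else 0) =
        (∏ k, mixAmp (β (Fin.last p)) (x k) (v (Fin.last p) k)) *
          Complex.exp (-Complex.I * ((γ (Fin.last p) / 2 : ℝ) : ℂ) * c (v (Fin.last p))) *
          pathAmp (Fin.init β) (Fin.init γ) c v := by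
      intro v
      simp only [Fin.snocEquiv_apply, Fin.snoc_last, Finset.sum_ite_eq', Finset.mem_univ, if_true,
        pathAmp, Fin.prod_univ_castSucc, Fin.succ_castSucc, Fin.snoc_castSucc, Fin.succ_last,
        Fin.init]
      ring
    simp only [hr]
    rw [Matrix.mulVec, dotProduct]
    simp only [exp_smul_mixer, Matrix.mulVec_diagonal, ih, Finset.mul_sum, mul_ite, mul_zero]
    rw [Finset.sum_comm]
    refine Finset.sum_congr rfl fun v _ => ?_
    rw [Finset.sum_ite_eq]
    simp only [Finset.mem_univ, if_true]
    ring

/-- Histories of one qubit: at each time a bit of the forward and of the backward evolution. -/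
abbrev History (p : ℕ) : Type := Fin (p + 1) → Bool × Bool

/-- The amplitude of a history. It is zero unless forward and backward evolution meet. -/
def histAmp {p : ℕ} (β : Fin p → ℝ) (a : History p) : ℂ :=
  if (a (Fin.last p)).1 = (a (Fin.last p)).2 then
    2⁻¹ * ∏ j : Fin p, (mixAmp (β j) (a j.succ).1 (a j.castSucc).1 *
      star (mixAmp (β j) (a j.succ).2 (a j.castSucc).2))
  else 0

/-- The phase accumulated by two histories with unit coupling is `-phase / 2`. -/
def phase {p : ℕ} (γ : Fin p → ℝ) (a b : History p) : ℝ :=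
  ∑ j : Fin p, γ j * (spin (a j.castSucc).1 * spin (b j.castSucc).1 -
    spin (a j.castSucc).2 * spin (b j.castSucc).2)

/-- The spin that is measured at the end of the forward evolution. -/
def finalSpin {p : ℕ} (a : History p) : ℝ := spin (a (Fin.last p)).1

/-- Histories of `n` qubits as pairs of a forward and a backward path. -/
def historiesEquiv (n p : ℕ) :
    (Fin n → History p) ≃ (Fin (p + 1) → Bits n) × (Fin (p + 1) → Bits n) where
  toFun a := (fun j k => (a k j).1, fun j k => (a k j).2)
  invFun v k j := (v.1 j k, v.2 j k)
  left_inv _ := rfl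
  right_inv _ := rfl

lemma prod_histAmp {n p : ℕ} (β : Fin p → ℝ) (a : Fin n → History p) :
    ∏ k, histAmp β (a k) = if ∀ k, (a k (Fin.last p)).1 = (a k (Fin.last p)).2 then
      (((1 / Real.sqrt (2 ^ n) : ℝ) : ℂ) *
        ∏ j : Fin p, ∏ k, mixAmp (β j) (a k j.succ).1 (a k j.castSucc).1) *
      star (((1 / Real.sqrt (2 ^ n) : ℝ) : ℂ) *
        ∏ j : Fin p, ∏ k, mixAmp (β j) (a k j.succ).2 (a k j.castSucc).2) else 0 := by
  simp only [histAmp]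
  rw [Finset.prod_ite_zero]
  simp only [Finset.mem_univ, true_imp_iff]
  congr 1
  have h2 : ((1 / Real.sqrt (2 ^ n) : ℝ) : ℂ) * ((1 / Real.sqrt (2 ^ n) : ℝ) : ℂ) = 2⁻¹ ^ n := by
    rw [← Complex.ofReal_mul, div_mul_div_comm, Real.mul_self_sqrt (by positivity)]
    simp
  rw [star_mul', star_prod]
  simp only [star_prod]
  rw [Finset.prod_comm (γ := Fin p), Finset.prod_comm (γ := Fin p)]
  simp only [Finset.prod_mul_distrib, Finset.prod_const, Finset.card_univ, Fintype.card_fin]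
  rw [← h2, Complex.star_def, Complex.conj_ofReal]
  ring

lemma prod_exp_phase {n p : ℕ} (γ : Fin p → ℝ) (J : Pairs n → ℝ) (v v' : Fin (p + 1) → Bits n) :
    (∏ j : Fin p, Complex.exp (-Complex.I * ((γ j / 2 : ℝ) : ℂ) * cost J (v j.castSucc))) *
      star (∏ j : Fin p, Complex.exp (-Complex.I * ((γ j / 2 : ℝ) : ℂ) * cost J (v' j.castSucc))) =
    ∏ e : Pairs n, Complex.exp (-Complex.I * ((phase γ (fun j => (v j e.1.1, v' j e.1.1))
      (fun j => (v j e.1.2, v' j e.1.2)) / 2 : ℝ) : ℂ) * J e) := by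
  rw [star_prod]
  simp only [Complex.star_def, ← Complex.exp_conj, map_mul, map_neg, Complex.conj_I,
    Complex.conj_ofReal, neg_neg]
  rw [← Complex.exp_sum, ← Complex.exp_sum, ← Complex.exp_sum, ← Complex.exp_add]
  congr 1
  simp only [cost, phase]
  push_cast
  simp only [Finset.mul_sum, Finset.sum_div, Finset.sum_mul]
  rw [Finset.sum_comm, Finset.sum_comm (γ := Fin p), ← Finset.sum_add_distrib]
  refine Finset.sum_congr rfl fun e _ => ?_
  rw [← Finset.sum_add_distrib]
  exact Finset.sum_congr rfl fun j _ => by ring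

/-- The energy as a sum over histories and over a marked pair. -/
theorem star_dotProduct_hamiltonian_eq_sum {n p : ℕ} (J : Pairs n → ℝ) (β γ : Fin p → ℝ) :
    star (qaoaState (hamiltonian J) p β γ) ⬝ᵥ
      (hamiltonian J *ᵥ qaoaState (hamiltonian J) p β γ) =
    ∑ e₀ : Pairs n, ∑ a : Fin n → History p, (∏ k, histAmp β (a k)) *
      ∏ e : Pairs n, ((if e = e₀ then
        ((finalSpin (a e.1.1) * finalSpin (a e.1.2) : ℝ) : ℂ) * J e else 1) *
        Complex.exp (-Complex.I * ((phase γ (a e.1.1) (a e.1.2) / 2 : ℝ) : ℂ) * J e)) := by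
  have hL : star (qaoaState (hamiltonian J) p β γ) ⬝ᵥ
      (hamiltonian J *ᵥ qaoaState (hamiltonian J) p β γ) =
      ∑ v : Fin (p + 1) → Bits n, ∑ v' : Fin (p + 1) → Bits n,
        if v (Fin.last p) = v' (Fin.last p) then
          pathAmp β γ (cost J) v * star (pathAmp β γ (cost J) v') * cost J (v (Fin.last p))
        else 0 := by
    rw [hamiltonian_eq_diagonal, dotProduct]
    simp only [Matrix.mulVec_diagonal, Pi.star_apply, qaoaState_eq_sum, star_sum, Finset.mul_sum,
      Finset.sum_mul]
    rw [Finset.sum_comm]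
    refine Finset.sum_congr rfl fun v _ => ?_
    rw [Finset.sum_comm]
    refine Finset.sum_congr rfl fun v' _ => ?_
    rw [Finset.sum_eq_single (v (Fin.last p))]
    · by_cases h : v (Fin.last p) = v' (Fin.last p)
      · simp only [h, if_true]; ring
      · simp [h, Ne.symm h]
    · intro x _ hx
      simp [hx.symm]
    · simp
  rw [hL, ← Fintype.sum_prod_type', ← (historiesEquiv n p).sum_comp, Finset.sum_comm]
  refine Finset.sum_congr rfl fun a _ => ?_
  simp only [historiesEquiv, Equiv.coe_fn_mk, Finset.prod_mul_distrib]
  rw [← Finset.mul_sum, prod_histAmp]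
  simp only [funext_iff]
  split_ifs with h
  · have e1 := prod_exp_phase γ J (fun j k => (a k j).1) (fun j k => (a k j).2)
    simp only [pathAmp, Finset.prod_mul_distrib, star_mul']
    rw [← Finset.sum_mul]
    -- The measured cost, a sum over edges, is written as a sum over a marked pair of products with
    -- a single nontrivial factor.
    have e2 : ∑ e₀ : Pairs n, ∏ e : Pairs n, (if e = e₀ then
        ((finalSpin (a e.1.1) * finalSpin (a e.1.2) : ℝ) : ℂ) * J e else 1) =
        cost J fun k => (a k (Fin.last p)).1 := by
      rw [cost]
      push_cast
      refine Finset.sum_congr rfl fun e _ => ?_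
      rw [Finset.prod_ite_eq']
      simp [finalSpin]
      ring
    rw [e2, ← e1]
    ring
  · simp

/-! ### The causal system of histories -/

lemma mixAmp_not_not (β : ℝ) (x y : Bool) : mixAmp β (!x) (!y) = mixAmp β x y := by
  cases x <;> cases y <;> simp [mixAmp]

lemma star_mixAmp (β : ℝ) (x y : Bool) : star (mixAmp β x y) =
    if x = y then Complex.cos (β / 2) else Complex.I * Complex.sin (β / 2) := by
  have hc : (starRingEnd ℂ) (Complex.cos (β / 2)) = Complex.cos (β / 2) := by
    rw [← Complex.cos_conj, map_div₀, Complex.conj_ofReal, Complex.conj_ofNat]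
  have hs : (starRingEnd ℂ) (Complex.sin (β / 2)) = Complex.sin (β / 2) := by
    rw [← Complex.sin_conj, map_div₀, Complex.conj_ofReal, Complex.conj_ofNat]
  unfold mixAmp
  split_ifs <;> simp [hc, hs]

/-- Unitarity of the mixer, in the form of a cancellation. -/
lemma mixAmp_not_mul_star (β : ℝ) (x : Bool) {y y' : Bool} (h : y ≠ y') :
    mixAmp β (!x) y * star (mixAmp β (!x) y') = -(mixAmp β x y * star (mixAmp β x y')) := by
  rw [star_mixAmp, star_mixAmp]
  cases x <;> cases y <;> cases y' <;> simp [mixAmp] at h ⊢ <;> ring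

lemma mixAmp_mul_star_self (β : ℝ) (x y : Bool) : mixAmp β x y * star (mixAmp β x y) =
    ((if x = y then Real.cos (β / 2) ^ 2 else Real.sin (β / 2) ^ 2 : ℝ) : ℂ) := by
  rw [star_mixAmp, mixAmp]
  split_ifs
  · push_cast; ring
  · push_cast
    linear_combination (-Complex.sin (β / 2) ^ 2) * Complex.I_sq

section Rank

variable {p : ℕ}

/-- One more than the last time at which forward and backward evolution differ, or `0`. -/
def histRank (a : History p) : ℕ :=
  Finset.univ.sup fun j : Fin (p + 1) => if (a j).1 = (a j).2 then 0 else (j : ℕ) + 1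

lemma eq_of_histRank_le {a : History p} {j : Fin (p + 1)} (h : histRank a ≤ j) :
    (a j).1 = (a j).2 := by
  by_contra hne
  have := Finset.le_sup (f := fun j : Fin (p + 1) => if (a j).1 = (a j).2 then 0 else (j : ℕ) + 1)
    (Finset.mem_univ j)
  simp only [hne, if_false] at this
  have h' : (j : ℕ) + 1 ≤ histRank a := this
  omega

lemma exists_ne_of_histRank_ne_zero {a : History p} (h : histRank a ≠ 0) :
    ∃ j : Fin (p + 1), histRank a = (j : ℕ) + 1 ∧ (a j).1 ≠ (a j).2 := by
  obtain ⟨j, _, hj⟩ := Finset.exists_mem_eq_sup Finset.univ Finset.univ_nonempty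
    fun j : Fin (p + 1) => if (a j).1 = (a j).2 then 0 else (j : ℕ) + 1
  have hj' : histRank a = if (a j).1 = (a j).2 then 0 else (j : ℕ) + 1 := hj
  by_cases hne : (a j).1 = (a j).2
  · rw [if_pos hne] at hj'
    exact absurd hj' h
  · exact ⟨j, by rw [hj', if_neg hne], hne⟩

lemma histRank_le (a : History p) : histRank a ≤ p + 1 := by
  refine Finset.sup_le fun j _ => ?_
  split_ifs <;> omega

lemma histRank_congr {a b : History p} (h : ∀ j, (a j).1 = (a j).2 ↔ (b j).1 = (b j).2) :
    histRank a = histRank b := by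
  simp only [histRank, h]

/-- Flip all bits of a history from the time `histRank` on. -/
def histBar (a : History p) : History p :=
  fun j => if histRank a ≤ j then (!(a j).1, !(a j).2) else a j

lemma histRank_histBar (a : History p) : histRank (histBar a) = histRank a := by
  refine histRank_congr fun j => ?_
  unfold histBar
  split_ifs <;> simp

lemma histBar_histBar (a : History p) : histBar (histBar a) = a := by
  funext j
  rw [histBar, histRank_histBar]
  unfold histBar
  split_ifs <;> simp

/-- The flip begins right after the last time `j₀` of disagreement. Later factors have both ends
flipped and earlier ones neither, so only the step from `j₀` to `j₀ + 1` changes, and there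
`mixAmp_not_mul_star` gives the sign. -/
lemma histAmp_histBar (β : Fin p → ℝ) (a : History p) (h : histRank a ≠ 0) :
    histAmp β (histBar a) = -histAmp β a := by
  obtain ⟨j₀, hj₀, hne⟩ := exists_ne_of_histRank_ne_zero h
  have hiff : ((histBar a) (Fin.last p)).1 = ((histBar a) (Fin.last p)).2 ↔
      (a (Fin.last p)).1 = (a (Fin.last p)).2 := by
    unfold histBar
    split_ifs <;> simp
  rw [histAmp, histAmp]
  simp only [hiff]
  -- If the two evolutions disagree at the final time, both amplitudes are zero.
  split_ifs with hlast
  swap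
  · simp
  obtain ⟨i₀, rfl⟩ : ∃ i : Fin p, i.castSucc = j₀ := by
    refine Fin.exists_castSucc_eq.2 ?_
    rintro rfl
    exact hne hlast
  have hfac : ∀ j : Fin p, mixAmp (β j) (histBar a j.succ).1 (histBar a j.castSucc).1 *
      star (mixAmp (β j) (histBar a j.succ).2 (histBar a j.castSucc).2) =
      (if j = i₀ then -1 else 1) * (mixAmp (β j) (a j.succ).1 (a j.castSucc).1 *
      star (mixAmp (β j) (a j.succ).2 (a j.castSucc).2)) := by
    intro j
    have hv : histRank a = (i₀ : ℕ) + 1 := hj₀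
    rcases lt_trichotomy j i₀ with hlt | rfl | hgt
    · have hlt' : (j : ℕ) < i₀ := hlt
      simp only [histBar, hv, Fin.val_succ, Fin.val_castSucc]
      rw [if_neg (by omega), if_neg (by omega), if_neg hlt.ne, one_mul]
    · have heq : (a j.succ).1 = (a j.succ).2 := eq_of_histRank_le (by rw [hv]; simp)
      simp only [histBar, hv, Fin.val_succ, Fin.val_castSucc]
      rw [if_pos le_rfl, if_neg (by omega)]
      dsimp only
      rw [← heq, mixAmp_not_mul_star _ _ hne]
      simp
    · have hgt' : (i₀ : ℕ) < j := hgt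
      simp only [histBar, hv, Fin.val_succ, Fin.val_castSucc]
      rw [if_pos (by omega), if_pos (by omega), if_neg hgt.ne', one_mul]
      simp only [mixAmp_not_not]
  simp only [hfac]
  rw [Finset.prod_mul_distrib, Finset.prod_ite_eq']
  simp

lemma histRank_eq_zero_iff (a : History p) : histRank a = 0 ↔ ∀ j, (a j).1 = (a j).2 := by
  refine ⟨fun h j => eq_of_histRank_le (by omega), fun h => ?_⟩
  simp [histRank, h]

lemma sum_histRank_eq_zero {M : Type*} [AddCommMonoid M] (f : History p → M) :
    ∑ a with histRank a = 0, f a = ∑ u : Fin (p + 1) → Bool, f fun j => (u j, u j) := by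
  refine Finset.sum_nbij' (fun a j => (a j).1) (fun u j => (u j, u j)) (by simp) ?_ ?_ (by simp) ?_
  · intro u _
    simp [histRank_eq_zero_iff]
  · intro a ha
    rw [Finset.mem_filter, histRank_eq_zero_iff] at ha
    funext j
    exact Prod.ext rfl (ha.2 j)
  · intro a ha
    rw [Finset.mem_filter, histRank_eq_zero_iff] at ha
    congr 1
    funext j
    exact Prod.ext rfl (ha.2 j).symm

/-- Total mass of a two-state Markov chain started from counting measure: the last bit sums out to
`1`, and the two initial bits remain. -/
lemma sum_prod_transition (p : ℕ) (P : Fin p → Bool → Bool → ℝ)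
    (hP : ∀ j t, P j true t + P j false t = 1) :
    ∑ u : Fin (p + 1) → Bool, ∏ j : Fin p, P j (u j.succ) (u j.castSucc) = 2 := by
  induction p with
  | zero => simp
  | succ p ih =>
    rw [← (Fin.snocEquiv fun _ : Fin (p + 2) => Bool).sum_comp, Fintype.sum_prod_type,
      Finset.sum_comm, ← ih (fun j => P j.castSucc) fun j => hP j.castSucc]
    refine Finset.sum_congr rfl fun u _ => ?_
    simp only [Fin.snocEquiv_apply, Fin.snoc_last, Fin.prod_univ_castSucc, Fin.succ_castSucc,
      Fin.snoc_castSucc, Fin.succ_last, Fintype.sum_bool]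
    rw [← mul_add, hP, mul_one]

/-- The amplitude of a history of rank zero. -/
def diagAmp (β : Fin p → ℝ) (u : Fin (p + 1) → Bool) : ℝ := 2⁻¹ * ∏ j : Fin p,
  if u j.succ = u j.castSucc then Real.cos (β j / 2) ^ 2 else Real.sin (β j / 2) ^ 2

lemma diagAmp_nonneg (β : Fin p → ℝ) (u : Fin (p + 1) → Bool) : 0 ≤ diagAmp β u := by
  refine mul_nonneg (by norm_num) (Finset.prod_nonneg fun j _ => ?_)
  split_ifs <;> positivity

lemma histAmp_diag (β : Fin p → ℝ) (u : Fin (p + 1) → Bool) :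
    histAmp β (fun j => (u j, u j)) = (diagAmp β u : ℂ) := by
  simp only [histAmp, diagAmp, if_true, mixAmp_mul_star_self, Complex.ofReal_mul,
    Complex.ofReal_prod, Complex.ofReal_inv, Complex.ofReal_ofNat]

lemma sum_diagAmp (β : Fin p → ℝ) : ∑ u, diagAmp β u = 1 := by
  simp only [diagAmp]
  rw [← Finset.mul_sum, sum_prod_transition p fun j s t =>
    if s = t then Real.cos (β j / 2) ^ 2 else Real.sin (β j / 2) ^ 2]
  · norm_num
  · intro j t
    cases t <;> simp

/-- The causal system of the histories of one qubit. -/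
def histSystem (β : Fin p → ℝ) : CausalSystem (History p) where
  amp := histAmp β
  rank := histRank
  bar := histBar
  bar_bar := histBar_histBar
  rank_bar := histRank_histBar
  amp_bar := histAmp_histBar β
  sum_amp := by
    rw [sum_histRank_eq_zero]
    simp only [histAmp_diag]
    rw [← Complex.ofReal_sum, sum_diagAmp, Complex.ofReal_one]
  sum_norm_amp := by
    rw [sum_histRank_eq_zero]
    simp only [histAmp_diag, Complex.norm_real, Real.norm_of_nonneg (diagAmp_nonneg β _)]
    exact sum_diagAmp β

lemma phase_comm (γ : Fin p → ℝ) (a b : History p) : phase γ a b = phase γ b a :=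
  Finset.sum_congr rfl fun j _ => by ring

/-- At the flipped times both histories have equal forward and backward bits, so these times
contribute zero before and after the flip. -/
lemma phase_histBar (γ : Fin p → ℝ) (a b : History p) (h : histRank b ≤ histRank a) :
    phase γ (histBar a) b = phase γ a b := by
  refine Finset.sum_congr rfl fun j _ => ?_
  unfold histBar
  split_ifs with hj
  · have ha := eq_of_histRank_le hj
    have hb := eq_of_histRank_le (h.trans hj)
    simp only [spin_not]
    rw [ha, hb]
    ring
  · rfl

lemma phase_eq_zero (γ : Fin p → ℝ) (a b : History p) (ha : histRank a = 0) (hb : histRank b = 0) :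
    phase γ a b = 0 := by
  rw [histRank_eq_zero_iff] at ha hb
  exact Finset.sum_eq_zero fun j _ => by rw [ha, hb]; ring

/-- Causality is a property of the phase alone, so it holds for the characteristic function of any
coupling law. -/
lemma isCausal_phase (β γ : Fin p → ℝ) (f : ℝ → ℂ) (hf : f 0 = 1) :
    (histSystem β).IsCausal fun a b => f (phase γ a b) where
  symm a b := by rw [phase_comm]
  bar_left a b h := congrArg f (phase_histBar γ a b h)
  eq_one a b ha hb := by rw [phase_eq_zero γ a b ha hb, hf]

/-- The global flip of a history. -/
def histNeg (a : History p) : History p := fun j => (!(a j).1, !(a j).2)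

lemma histNeg_histNeg (a : History p) : histNeg (histNeg a) = a := by
  funext j; simp [histNeg]

lemma histRank_histNeg (a : History p) : histRank (histNeg a) = histRank a :=
  histRank_congr fun j => by simp [histNeg]

lemma histAmp_histNeg (β : Fin p → ℝ) (a : History p) : histAmp β (histNeg a) = histAmp β a := by
  simp [histAmp, histNeg, mixAmp_not_not]

lemma phase_histNeg (γ : Fin p → ℝ) (a b : History p) :
    phase γ (histNeg a) b = -phase γ a b := by
  rw [phase, phase, ← Finset.sum_neg_distrib]
  exact Finset.sum_congr rfl fun j _ => by simp [histNeg]; ring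

lemma phase_histNeg_right (γ : Fin p → ℝ) (a b : History p) :
    phase γ a (histNeg b) = -phase γ a b := by
  rw [phase_comm, phase_histNeg, phase_comm]

lemma finalSpin_histNeg (a : History p) : finalSpin (histNeg a) = -finalSpin a := by
  simp [finalSpin, histNeg]

lemma phase_div (γ : Fin p → ℝ) (s : ℝ) (a b : History p) :
    phase (fun j => γ j / s) a b = phase γ a b / s := by
  rw [phase, phase, Finset.sum_div]
  exact Finset.sum_congr rfl fun j _ => by ring

end Rank

/-! ### Averages over independent couplings -/

lemma card_pairs (n : ℕ) : 2 * (Fintype.card (Pairs n) : ℝ) = n * (n - 1) := by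
  induction n with
  | zero => simp
  | succ n ih =>
    -- Pairs are counted by a product in `Multiplicative ℕ` in which every pair contributes one.
    have h := prod_pairs_succ (n := n) fun _ _ => Multiplicative.ofAdd (1 : ℕ)
    simp only [Finset.prod_const, Finset.card_univ, Fintype.card_fin,
      ← ofAdd_nsmul, smul_eq_mul, mul_one] at h
    have h' : Fintype.card (Pairs (n + 1)) = n + Fintype.card (Pairs n) := by
      simpa [← ofAdd_add] using h
    rw [h']
    push_cast
    linarith

/-- The limit of the energy per qubit, in terms of the first-order expansion `1 + ψ / n` of the
characteristic function of the couplings and of their limiting first moment `h`. -/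
def limitEnergy {p : ℕ} (β : Fin p → ℝ) (ψ h : History p → History p → ℂ) : ℂ :=
  ∑ a, ∑ b, histAmp β a * histAmp β b * (((finalSpin a * finalSpin b : ℝ) : ℂ) * h a b) *
    ((histSystem β).cavity ψ (p + 1) a * (histSystem β).cavity ψ (p + 1) b)

variable {p : ℕ}

lemma integrable_mul_exp {μ : Measure ℝ} (hμ : Integrable (fun x : ℝ => x) μ) (x : ℝ) :
    Integrable (fun J : ℝ => (J : ℂ) * Complex.exp (-Complex.I * ((x / 2 : ℝ) : ℂ) * J)) μ := by
  refine (hμ.ofReal (𝕜 := ℂ)).mul_bdd (c := 1) (by fun_prop) (ae_of_all _ fun J => ?_)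
  have : -Complex.I * ((x / 2 : ℝ) : ℂ) * J = ((-(x / 2) * J : ℝ) : ℂ) * Complex.I := by
    push_cast; ring
  rw [this, Complex.norm_exp_ofReal_mul_I]

lemma integrable_exp (μ : Measure ℝ) [IsFiniteMeasure μ] (x : ℝ) :
    Integrable (fun J : ℝ => Complex.exp (-Complex.I * ((x / 2 : ℝ) : ℂ) * J)) μ := by
  refine Integrable.of_bound (by fun_prop) 1 (ae_of_all _ fun J => ?_)
  have : -Complex.I * ((x / 2 : ℝ) : ℂ) * J = ((-(x / 2) * J : ℝ) : ℂ) * Complex.I := by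
    push_cast; ring
  rw [this, Complex.norm_exp_ofReal_mul_I]

/-- The average energy as a sum over histories. -/
theorem integral_energy_eq {n : ℕ} (μ : Measure ℝ) [IsProbabilityMeasure μ]
    (hμ : Integrable (fun x : ℝ => x) μ) (β γ : Fin p → ℝ) :
    ∫ J, energy J β γ ∂(Measure.pi fun _ : Pairs n => μ) =
      (∑ e₀ : Pairs n, ∑ a : Fin n → History p, (∏ k, histAmp β (a k)) *
        ∏ e : Pairs n, (if e = e₀ then ((finalSpin (a e.1.1) * finalSpin (a e.1.2) : ℝ) : ℂ) *
          ∫ J : ℝ, (J : ℂ) * Complex.exp (-Complex.I *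
            ((phase γ (a e.1.1) (a e.1.2) / 2 : ℝ) : ℂ) * J) ∂μ
        else ∫ J : ℝ, Complex.exp (-Complex.I *
            ((phase γ (a e.1.1) (a e.1.2) / 2 : ℝ) : ℂ) * J) ∂μ)).re := by
  set f : Pairs n → (Fin n → History p) → Pairs n → ℝ → ℂ := fun e₀ a e J =>
    (if e = e₀ then ((finalSpin (a e.1.1) * finalSpin (a e.1.2) : ℝ) : ℂ) * J else 1) *
      Complex.exp (-Complex.I * ((phase γ (a e.1.1) (a e.1.2) / 2 : ℝ) : ℂ) * J) with hf
  have hint : ∀ e₀ a e, Integrable (f e₀ a e) μ := by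
    intro e₀ a e
    simp only [hf]
    split_ifs
    · simp only [mul_assoc]
      have := (integrable_mul_exp hμ (phase γ (a e.1.1) (a e.1.2))).const_mul
        ((finalSpin (a e.1.1) * finalSpin (a e.1.2) : ℝ) : ℂ)
      simpa only [mul_assoc] using this
    · simpa only [one_mul] using integrable_exp μ (phase γ (a e.1.1) (a e.1.2))
  have hval : ∀ e₀ a e, ∫ J, f e₀ a e J ∂μ =
      if e = e₀ then ((finalSpin (a e.1.1) * finalSpin (a e.1.2) : ℝ) : ℂ) *
          ∫ J : ℝ, (J : ℂ) * Complex.exp (-Complex.I *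
            ((phase γ (a e.1.1) (a e.1.2) / 2 : ℝ) : ℂ) * J) ∂μ
        else ∫ J : ℝ, Complex.exp (-Complex.I *
            ((phase γ (a e.1.1) (a e.1.2) / 2 : ℝ) : ℂ) * J) ∂μ := by
    intro e₀ a e
    simp only [hf]
    split_ifs
    · rw [← integral_const_mul]
      simp only [mul_assoc]
    · simp only [one_mul]
  have hprod : ∀ e₀ a, Integrable (fun J : Pairs n → ℝ => (∏ k, histAmp β (a k)) *
      ∏ e, f e₀ a e (J e)) (Measure.pi fun _ : Pairs n => μ) := fun e₀ a =>
    (Integrable.fintype_prod (f := f e₀ a) fun e => hint e₀ a e).const_mul _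
  have henergy : ∀ J : Pairs n → ℝ, energy J β γ = RCLike.re (∑ e₀ : Pairs n,
      ∑ a : Fin n → History p, (∏ k, histAmp β (a k)) * ∏ e, f e₀ a e (J e)) := by
    intro J
    rw [energy, star_dotProduct_hamiltonian_eq_sum]
    rfl
  simp only [henergy]
  have hsum : ∀ e₀, Integrable (fun J : Pairs n → ℝ => ∑ a : Fin n → History p,
      (∏ k, histAmp β (a k)) * ∏ e, f e₀ a e (J e)) (Measure.pi fun _ : Pairs n => μ) := fun e₀ =>
    integrable_finsetSum _ fun a _ => hprod e₀ a
  have hsum' : Integrable (fun J : Pairs n → ℝ => ∑ e₀ : Pairs n, ∑ a : Fin n → History p,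
      (∏ k, histAmp β (a k)) * ∏ e, f e₀ a e (J e)) (Measure.pi fun _ : Pairs n => μ) :=
    integrable_finsetSum _ fun e₀ _ => hsum e₀
  rw [integral_re hsum', integral_finsetSum Finset.univ fun e₀ _ => hsum e₀,
    RCLike.re_eq_complex_re]
  congr 1
  refine Finset.sum_congr rfl fun e₀ _ => ?_
  rw [integral_finsetSum Finset.univ fun a _ => hprod e₀ a]
  refine Finset.sum_congr rfl fun a _ => ?_
  rw [integral_const_mul, integral_fintype_prod_eq_prod (f e₀ a)]
  simp only [hval]

/-- The energy per qubit converges if the couplings have a limit to first order in `1 / n`. -/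
theorem tendsto_energy (μ : ℕ → Measure ℝ) [∀ n, IsProbabilityMeasure (μ n)]
    (hμ : ∀ n, Integrable (fun x : ℝ => x) (μ n)) (β γ : Fin p → ℝ) (s : ℝ) {ψ h : ℝ → ℂ}
    (hψ : ∀ x : ℝ, Tendsto (fun n : ℕ => (n : ℂ) *
      ((∫ J : ℝ, Complex.exp (-Complex.I * ((x / 2 : ℝ) : ℂ) * J) ∂(μ n)) - 1)) atTop (𝓝 (ψ x)))
    (hh : ∀ x : ℝ, Tendsto (fun n : ℕ => ((((n : ℝ) - 1) / 2 / s : ℝ) : ℂ) *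
      ∫ J : ℝ, (J : ℂ) * Complex.exp (-Complex.I * ((x / 2 : ℝ) : ℂ) * J) ∂(μ n))
      atTop (𝓝 (h x))) :
    Tendsto (fun n : ℕ => (∫ J, energy J β γ ∂(Measure.pi fun _ : Pairs n => μ n)) / (n * s)) atTop
      (𝓝 (limitEnergy β (fun a b => ψ (phase γ a b)) fun a b => h (phase γ a b)).re) := by
  set w : ℕ → History p → History p → ℂ := fun n a b =>
    ∫ J : ℝ, Complex.exp (-Complex.I * ((phase γ a b / 2 : ℝ) : ℂ) * J) ∂(μ n) with hw
  set k : ℕ → History p → History p → ℂ := fun n a b =>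
    ∫ J : ℝ, (J : ℂ) * Complex.exp (-Complex.I * ((phase γ a b / 2 : ℝ) : ℂ) * J) ∂(μ n) with hk
  have hcausal : ∀ n, (histSystem β).IsCausal (w n) := fun n =>
    isCausal_phase β γ (fun x => ∫ J : ℝ, Complex.exp (-Complex.I * ((x / 2 : ℝ) : ℂ) * J) ∂(μ n))
      (by simp)
  -- Rank `p + 1` is attained by histories that disagree at the final time. They have amplitude zero
  -- but still belong to the label set.
  have hbelow : (histSystem β).below (p + 1) = Finset.univ := by
    ext a
    simp only [CausalSystem.mem_below, Finset.mem_univ, iff_true]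
    exact histRank_le a
  have hlim : Tendsto (fun n : ℕ => ∑ a, ∑ b, histAmp β a * histAmp β b *
      (((finalSpin a * finalSpin b : ℝ) : ℂ) * (((((n : ℝ) - 1) / 2 / s : ℝ) : ℂ) * k n a b)) *
      (histSystem β).partition (w n) (p + 1) (n - 2) (env (w n) [a, b])) atTop
      (𝓝 (limitEnergy β (fun a b => ψ (phase γ a b)) fun a b => h (phase γ a b))) := by
    refine tendsto_finsetSum _ fun a _ => tendsto_finsetSum _ fun b _ => ?_
    refine (((hh _).const_mul _).const_mul _).mul ?_
    have := (histSystem β).tendsto_partition hcausal (ψ := fun a b => ψ (phase γ a b))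
      (fun a b => hψ _) (p + 1) [a, b]
    simpa using this
  have hre := (Complex.continuous_re.tendsto _).comp hlim
  refine hre.congr' ?_
  filter_upwards [eventually_ge_atTop 2] with n hn
  obtain ⟨m, rfl⟩ : ∃ m, n = m + 2 := ⟨n - 2, by omega⟩
  rw [integral_energy_eq (μ (m + 2)) (hμ _) β γ, Function.comp_apply]
  have hmark : ∀ e₀ : Pairs (m + 2), ∑ a : Fin (m + 2) → History p, (∏ k, histAmp β (a k)) *
        ∏ e : Pairs (m + 2), (if e = e₀ then
          ((finalSpin (a e.1.1) * finalSpin (a e.1.2) : ℝ) : ℂ) * k (m + 2) (a e.1.1) (a e.1.2)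
        else w (m + 2) (a e.1.1) (a e.1.2)) = ∑ a, ∑ b, histAmp β a * histAmp β b *
          (((finalSpin a * finalSpin b : ℝ) : ℂ) * k (m + 2) a b) *
          (histSystem β).partition (w (m + 2)) (p + 1) m (env (w (m + 2)) [a, b]) := by
    intro e₀
    rw [CausalSystem.partition, hbelow]
    refine sum_marked_pair (histAmp β) (g := fun a b =>
      ((finalSpin a * finalSpin b : ℝ) : ℂ) * k (m + 2) a b) (hcausal _).symm ?_ e₀
    intro a b
    simp only [hk]
    rw [phase_comm, mul_comm (finalSpin a)]
  have hsum := Finset.sum_congr rfl fun e₀ (_ : e₀ ∈ (Finset.univ : Finset (Pairs (m + 2)))) =>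
    hmark e₀
  refine Eq.trans ?_ (congrArg (fun z : ℂ => z.re / (((m + 2 : ℕ) : ℝ) * s)) hsum.symm)
  -- All marked pairs contribute the same amount, and their number over `n * s` is the prefactor of
  -- the first moment in the hypothesis `hh`.
  have hcard : (((m + 2 : ℕ) : ℝ) - 1) / 2 / s =
      (Fintype.card (Pairs (m + 2)) : ℝ) / ((m + 2 : ℕ) * s) := by
    have h2 := card_pairs (m + 2)
    have h3 : (Fintype.card (Pairs (m + 2)) : ℝ) =
        ((m + 2 : ℕ) : ℝ) * (((m + 2 : ℕ) : ℝ) - 1) / 2 := by linarith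
    have h4 : ((m + 2 : ℕ) : ℝ) ≠ 0 := by positivity
    rw [h3]
    field_simp
  rw [Finset.sum_const, Finset.card_univ, nsmul_eq_mul, ← Complex.div_ofReal_re]
  congr 1
  rw [hcard, mul_div_right_comm, Finset.mul_sum]
  refine Finset.sum_congr rfl fun a _ => ?_
  rw [Finset.mul_sum]
  refine Finset.sum_congr rfl fun b _ => ?_
  push_cast
  ring

/-! ### The Sherrington–Kirkpatrick and Erdős–Rényi models -/

lemma tendsto_nat_mul_exp_div_sub_one (c : ℂ) :
    Tendsto (fun n : ℕ => (n : ℂ) * (Complex.exp (c / n) - 1)) atTop (𝓝 c) := by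
  have hd : HasDerivAt (fun t : ℂ => Complex.exp (t * c)) c 0 := by
    have h := ((hasDerivAt_id (0 : ℂ)).mul_const c).cexp
    simpa using h
  have h1 : Tendsto (fun n : ℕ => (n : ℂ)⁻¹) atTop (𝓝[≠] 0) := by
    refine tendsto_nhdsWithin_iff.2 ⟨tendsto_inv_atTop_nhds_zero_nat, ?_⟩
    filter_upwards [eventually_ge_atTop 1] with n hn
    have : (n : ℂ) ≠ 0 := by exact_mod_cast (by omega : n ≠ 0)
    simpa using this
  refine ((hasDerivAt_iff_tendsto_slope_zero.1 hd).comp h1).congr fun n => ?_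
  simp [div_eq_inv_mul]

lemma integral_exp_gaussianReal (v : NNReal) (z : ℂ) :
    ∫ J : ℝ, Complex.exp (z * J) ∂(gaussianReal 0 v) = Complex.exp (v * z ^ 2 / 2) := by
  simpa [complexMGF] using complexMGF_id_gaussianReal (μ := 0) (v := v) z

/-- The derivative of the complex moment generating function is computed once under the integral and
once from its closed form. -/
lemma integral_mul_exp_gaussianReal (v : NNReal) (z : ℂ) :
    ∫ J : ℝ, (J : ℂ) * Complex.exp (z * J) ∂(gaussianReal 0 v) =
      v * z * Complex.exp (v * z ^ 2 / 2) := by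
  have h1 : HasDerivAt (complexMGF id (gaussianReal 0 v))
      (∫ J : ℝ, (J : ℂ) * Complex.exp (z * J) ∂(gaussianReal 0 v)) z :=
    hasDerivAt_complexMGF (by rw [integrableExpSet_id_gaussianReal]; simp)
  have h2 : HasDerivAt (complexMGF id (gaussianReal 0 v))
      (v * z * Complex.exp (v * z ^ 2 / 2)) z := by
    have e : complexMGF id (gaussianReal 0 v) = fun z => Complex.exp (v * z ^ 2 / 2) := by
      funext z
      simpa using complexMGF_id_gaussianReal (μ := 0) (v := v) z
    rw [e]
    have h := ((((hasDerivAt_id z).pow 2).const_mul (v : ℂ)).div_const 2).cexp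
    convert! h using 1
    simp
    ring
  exact h1.unique h2

theorem tendsto_energy_sk (β γ : Fin p → ℝ) :
    Tendsto (fun n : ℕ => (∫ J, energy J β γ ∂(skLaw n)) / (n : ℝ)) atTop
      (𝓝 (limitEnergy β (fun a b => -(phase γ a b : ℂ) ^ 2 / 8)
        fun a b => -Complex.I * phase γ a b / 4).re) := by
  have h := tendsto_energy (fun n : ℕ => gaussianReal 0 ((n : NNReal)⁻¹))
    (fun n => (memLp_id_gaussianReal 1).integrable (by simp)) β γ 1
    (ψ := fun x => -(x : ℂ) ^ 2 / 8) (h := fun x => -Complex.I * x / 4) ?_ ?_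
  · simp only [mul_one] at h
    exact h
  · intro x
    refine (tendsto_nat_mul_exp_div_sub_one (-(x : ℂ) ^ 2 / 8)).congr fun n => ?_
    rw [integral_exp_gaussianReal]
    congr 3
    push_cast
    linear_combination (-(x : ℂ) ^ 2 / (8 * n)) * Complex.I_sq
  · intro x
    have h1 : Tendsto (fun n : ℕ => Complex.exp ((-(x : ℂ) ^ 2 / 8) / n)) atTop (𝓝 1) := by
      have h0 : Tendsto (fun n : ℕ => (-(x : ℂ) ^ 2 / 8) * (n : ℂ)⁻¹) atTop
          (𝓝 ((-(x : ℂ) ^ 2 / 8) * 0)) := tendsto_inv_atTop_nhds_zero_nat.const_mul _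
      rw [mul_zero] at h0
      have := (Complex.continuous_exp.tendsto 0).comp h0
      rw [Complex.exp_zero] at this
      exact this
    have h2 : Tendsto (fun n : ℕ => (1 - (n : ℂ)⁻¹) * (-Complex.I * x / 4)) atTop
        (𝓝 ((1 - 0) * (-Complex.I * x / 4))) :=
      (tendsto_const_nhds.sub tendsto_inv_atTop_nhds_zero_nat).mul_const _
    have h3 := h2.mul h1
    rw [sub_zero, one_mul, mul_one] at h3
    refine h3.congr' ?_
    filter_upwards [eventually_ge_atTop 1] with n hn
    have hn' : (n : ℂ) ≠ 0 := by exact_mod_cast (by omega : n ≠ 0)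
    rw [integral_mul_exp_gaussianReal]
    have e : (((n : NNReal)⁻¹ : NNReal) : ℂ) * (-Complex.I * ((x / 2 : ℝ) : ℂ)) ^ 2 / 2 =
        (-(x : ℂ) ^ 2 / 8) / n := by
      push_cast
      linear_combination ((x : ℂ) ^ 2 / (8 * n)) * Complex.I_sq
    rw [e]
    push_cast
    field_simp
    ring

theorem tendsto_energy_er (β γ : Fin p → ℝ) (d : ℝ) (hd : 0 < d) :
    Tendsto (fun n : ℕ => (∫ J, energy J β γ ∂(erLaw n (d / ((n : ℝ) - 1)))) / ((n : ℝ) * d)) atTop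
      (𝓝 (limitEnergy β
        (fun a b => d * (Complex.exp (-Complex.I * ((phase γ a b / 2 : ℝ) : ℂ)) - 1))
        fun a b => Complex.exp (-Complex.I * ((phase γ a b / 2 : ℝ) : ℂ)) / 2).re) := by
  -- Once `n ≥ d + 1` the edge probability lies in `[0, 1]` and the projection has no effect.
  have hq : ∀ᶠ n : ℕ in atTop, 1 < n ∧
      (Set.projIcc (0 : ℝ) 1 zero_le_one (d / ((n : ℝ) - 1)) : ℝ) = d / ((n : ℝ) - 1) := by
    filter_upwards [eventually_gt_atTop 1, tendsto_natCast_atTop_atTop.eventually_ge_atTop (d + 1)]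
      with n hn hnd
    have h1 : (0 : ℝ) < (n : ℝ) - 1 := by linarith
    refine ⟨hn, ?_⟩
    rw [Set.projIcc_of_mem zero_le_one ⟨by positivity, by rw [div_le_one h1]; linarith⟩]
  refine tendsto_energy
    (fun n : ℕ => bernoulliMeasure (1 : ℝ) 0 (Set.projIcc 0 1 zero_le_one (d / ((n : ℝ) - 1))))
    (fun n => integrable_bernoulliMeasure _ _ _ _) β γ d
    (ψ := fun x => d * (Complex.exp (-Complex.I * ((x / 2 : ℝ) : ℂ)) - 1))
    (h := fun x => Complex.exp (-Complex.I * ((x / 2 : ℝ) : ℂ)) / 2) ?_ ?_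
  · intro x
    have h1 : Tendsto (fun n : ℕ => (1 - (n : ℂ)⁻¹)⁻¹ *
        (d * (Complex.exp (-Complex.I * ((x / 2 : ℝ) : ℂ)) - 1))) atTop
        (𝓝 ((1 - 0)⁻¹ * (d * (Complex.exp (-Complex.I * ((x / 2 : ℝ) : ℂ)) - 1)))) :=
      ((tendsto_const_nhds.sub tendsto_inv_atTop_nhds_zero_nat).inv₀ (by simp)).mul_const _
    rw [sub_zero, inv_one, one_mul] at h1
    refine h1.congr' ?_
    filter_upwards [hq] with n hn
    rw [integral_bernoulliMeasure, hn.2]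
    have hn0 : (n : ℂ) ≠ 0 := by exact_mod_cast (by omega : n ≠ 0)
    have hn1 : (n : ℂ) - 1 ≠ 0 := by
      rw [sub_ne_zero]
      exact_mod_cast (by omega : n ≠ 1)
    simp only [Complex.ofReal_one, Complex.ofReal_zero, mul_zero, mul_one, Complex.exp_zero,
      Complex.real_smul]
    push_cast
    field_simp
    ring
  · intro x
    refine tendsto_const_nhds.congr' ?_
    filter_upwards [hq] with n hn
    rw [integral_bernoulliMeasure, hn.2]
    have hd0 : (d : ℂ) ≠ 0 := by exact_mod_cast hd.ne'
    have hn1 : (n : ℂ) - 1 ≠ 0 := by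
      rw [sub_ne_zero]
      exact_mod_cast (by omega : n ≠ 1)
    simp only [Complex.ofReal_one, Complex.ofReal_zero, zero_mul, mul_one, one_mul, smul_zero,
      add_zero, Complex.real_smul]
    push_cast
    field_simp

/-! ### Comparison of the two limits -/

lemma sum_histNeg {M : Type*} [AddCommMonoid M] (f : History p → M) :
    ∑ a, f (histNeg a) = ∑ a, f a :=
  Finset.sum_nbij' histNeg histNeg (by simp) (by simp) (by simp [histNeg_histNeg])
    (by simp [histNeg_histNeg]) (by simp)

lemma sum_level_histNeg {M : Type*} [AddCommMonoid M] (β : Fin p → ℝ) (t : ℕ)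
    (f : History p → M) :
    ∑ a ∈ (histSystem β).level t, f (histNeg a) = ∑ a ∈ (histSystem β).level t, f a :=
  Finset.sum_nbij' histNeg histNeg
    (fun a ha => by
      rw [CausalSystem.mem_level] at ha ⊢
      exact (histRank_histNeg a).trans ha)
    (fun a ha => by
      rw [CausalSystem.mem_level] at ha ⊢
      exact (histRank_histNeg a).trans ha)
    (by simp [histNeg_histNeg]) (by simp [histNeg_histNeg]) (by simp)

lemma amp_histNeg (β : Fin p → ℝ) (a : History p) :
    (histSystem β).amp (histNeg a) = (histSystem β).amp a := histAmp_histNeg β a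

lemma cavity_histNeg (β : Fin p → ℝ) {ψ : History p → History p → ℂ}
    (hψ : ∀ a b, ψ (histNeg a) (histNeg b) = ψ a b) (t : ℕ) (a : History p) :
    (histSystem β).cavity ψ t (histNeg a) = (histSystem β).cavity ψ t a := by
  induction t generalizing a with
  | zero =>
    simp only [CausalSystem.cavity]
    rw [← sum_level_histNeg]
    simp only [hψ, amp_histNeg]
  | succ t ih =>
    simp only [CausalSystem.cavity]
    rw [ih, ← sum_level_histNeg]
    simp only [hψ, amp_histNeg, ih]

/-- Only the part of the interaction that is even under a global flip matters. -/
lemma cavity_even (β : Fin p → ℝ) {ψ : History p → History p → ℂ}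
    (hψ : ∀ a b, ψ (histNeg a) (histNeg b) = ψ a b) (t : ℕ) :
    (histSystem β).cavity (fun a b => (ψ a b + ψ a (histNeg b)) / 2) t =
      (histSystem β).cavity ψ t := by
  have key : ∀ t (f : History p → ℂ) a, (∀ b, f (histNeg b) = f b) →
      ∑ b ∈ (histSystem β).level t, f b * ((ψ a b + ψ a (histNeg b)) / 2) =
      ∑ b ∈ (histSystem β).level t, f b * ψ a b := by
    intro t f a hf
    have h := sum_level_histNeg β t fun b => f b * ψ a b
    simp only [hf] at h
    have e : ∑ b ∈ (histSystem β).level t, f b * ((ψ a b + ψ a (histNeg b)) / 2) =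
        (∑ b ∈ (histSystem β).level t, f b * ψ a b +
          ∑ b ∈ (histSystem β).level t, f b * ψ a (histNeg b)) / 2 := by
      rw [← Finset.sum_add_distrib, Finset.sum_div]
      exact Finset.sum_congr rfl fun b _ => by ring
    rw [e, h, add_self_div_two]
  induction t with
  | zero =>
    funext a
    simp only [CausalSystem.cavity]
    rw [key 0 _ a (amp_histNeg β)]
  | succ t ih =>
    funext a
    simp only [CausalSystem.cavity, ih]
    rw [key (t + 1) (fun b => (histSystem β).amp b * (histSystem β).cavity ψ t b) a fun b => by
      rw [amp_histNeg, cavity_histNeg β hψ]]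

/-- Flipping `b` negates `finalSpin b` and preserves amplitude and cavity factors, so the part of
`h` that is even in `b` cancels. -/
lemma limitEnergy_even_odd (β : Fin p → ℝ) {ψ : History p → History p → ℂ}
    (hψ : ∀ a b, ψ (histNeg a) (histNeg b) = ψ a b) (h : History p → History p → ℂ) :
    limitEnergy β (fun a b => (ψ a b + ψ a (histNeg b)) / 2)
      (fun a b => (h a b - h a (histNeg b)) / 2) = limitEnergy β ψ h := by
  rw [limitEnergy, limitEnergy]
  simp only [cavity_even β hψ]
  refine Finset.sum_congr rfl fun a _ => ?_
  have e := sum_histNeg fun b => histAmp β a * histAmp β b *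
    (((finalSpin a * finalSpin b : ℝ) : ℂ) * h a b) *
    ((histSystem β).cavity ψ (p + 1) a * (histSystem β).cavity ψ (p + 1) b)
  simp only [histAmp_histNeg, finalSpin_histNeg, cavity_histNeg β hψ] at e
  refine Eq.trans ?_ (add_self_div_two _)
  nth_rewrite 1 [← e]
  rw [← Finset.sum_add_distrib, Finset.sum_div]
  refine Finset.sum_congr rfl fun b _ => ?_
  push_cast
  ring

lemma limitEnergy_const_mul (β : Fin p → ℝ) (ψ h : History p → History p → ℂ) (c : ℂ) :
    limitEnergy β ψ (fun a b => c * h a b) = c * limitEnergy β ψ h := by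
  simp only [limitEnergy, Finset.mul_sum]
  exact Finset.sum_congr rfl fun a _ => Finset.sum_congr rfl fun b _ => by ring

lemma differentiable_cavity {A : Type*} [Fintype A] (𝒮 : CausalSystem A) (t : ℕ) (a : A) :
    Differentiable ℂ fun ψ : A → A → ℂ => 𝒮.cavity ψ t a := by
  have hψ : ∀ a b : A, Differentiable ℂ fun ψ : A → A → ℂ => ψ a b := fun a b => by fun_prop
  induction t generalizing a with
  | zero =>
    simp only [CausalSystem.cavity]
    fun_prop
  | succ t ih =>
    simp only [CausalSystem.cavity]
    fun_prop

lemma differentiable_limitEnergy (β : Fin p → ℝ) :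
    Differentiable ℂ fun x : (History p → History p → ℂ) × (History p → History p → ℂ) =>
      limitEnergy β x.1 x.2 := by
  have h1 : ∀ a, Differentiable ℂ
      fun x : (History p → History p → ℂ) × (History p → History p → ℂ) =>
        (histSystem β).cavity x.1 (p + 1) a :=
    fun a => (differentiable_cavity (histSystem β) (p + 1) a).comp differentiable_fst
  unfold limitEnergy
  fun_prop

/-- Under the flip of one history the even part of `exp (-i x)` is `cos x` and the odd part `-i sin
x`. The factor `√d` is absorbed into the first moment. -/
lemma limitEnergy_er (β γ : Fin p → ℝ) (d : ℕ) :
    Real.sqrt d * limitEnergy β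
        (fun a b => ((d : ℝ) : ℂ) * (Complex.exp (-Complex.I *
          ((phase (fun j => γ j / Real.sqrt d) a b / 2 : ℝ) : ℂ)) - 1))
        (fun a b => Complex.exp (-Complex.I *
          ((phase (fun j => γ j / Real.sqrt d) a b / 2 : ℝ) : ℂ)) / 2) =
      limitEnergy β
        (fun a b => ((d * (Real.cos (phase γ a b / Real.sqrt d / 2) - 1) : ℝ) : ℂ))
        (fun a b => -Complex.I / 2 *
          ((Real.sqrt d * Real.sin (phase γ a b / Real.sqrt d / 2) : ℝ) : ℂ)) := by
  have hexp : ∀ x : ℝ, Complex.exp (-Complex.I * x) =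
      Complex.cos x - Complex.sin x * Complex.I := by
    intro x
    have : -Complex.I * (x : ℂ) = (-x : ℂ) * Complex.I := by ring
    rw [this, Complex.exp_mul_I, Complex.cos_neg, Complex.sin_neg]
    ring
  rw [← limitEnergy_const_mul, ← limitEnergy_even_odd]
  · congr 1
    · funext a b
      rw [phase_histNeg_right, phase_div, neg_div, Complex.ofReal_neg, hexp]
      rw [← Complex.ofReal_neg, hexp, Complex.ofReal_neg, Complex.cos_neg, Complex.sin_neg]
      push_cast
      ring
    · funext a b
      rw [phase_histNeg_right, phase_div, neg_div, Complex.ofReal_neg, hexp]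
      rw [← Complex.ofReal_neg, hexp, Complex.ofReal_neg, Complex.cos_neg, Complex.sin_neg]
      push_cast
      ring
  · intro a b
    rw [phase_histNeg, phase_histNeg_right, neg_neg]

/-! ### Taylor expansion in `1 / √d` -/

lemma isBigO_cos_sub (φ : ℝ) : (fun d : ℕ => ((d * (Real.cos (φ / Real.sqrt d / 2) - 1) : ℝ) : ℂ) -
    (-(φ : ℂ) ^ 2 / 8)) =O[atTop] fun d : ℕ => 1 / (d : ℝ) := by
  -- The fourth-order remainder gives the constant `5 φ ^ 4 / 1536`, of which `φ ^ 4` is a crude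
  -- majorant. The condition `d ≥ φ ^ 2` brings the argument into the range of `Real.cos_bound`.
  refine Asymptotics.IsBigO.of_bound (φ ^ 4) ?_
  filter_upwards [eventually_ge_atTop 1, tendsto_natCast_atTop_atTop.eventually_ge_atTop (φ ^ 2)]
    with d hd hdφ
  have hd' : (0 : ℝ) < d := by exact_mod_cast hd
  set s := Real.sqrt d with hs
  have hs0 : 0 < s := Real.sqrt_pos.2 hd'
  have hs2 : s ^ 2 = d := Real.sq_sqrt hd'.le
  have hx2 : (φ / s / 2) ^ 2 = φ ^ 2 / d / 4 := by rw [div_pow, div_pow, hs2]; ring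
  have hx : |φ / s / 2| ≤ 1 := by
    rw [← sq_le_one_iff_abs_le_one, hx2]
    have : φ ^ 2 / d ≤ 1 := by rwa [div_le_one hd']
    linarith
  have hcos := Real.cos_bound hx
  have hx4 : |φ / s / 2| ^ 4 = φ ^ 4 / d ^ 2 / 16 := by
    have : |φ / s / 2| ^ 4 = ((φ / s / 2) ^ 2) ^ 2 := by
      rw [← pow_mul, show 2 * 2 = 4 from rfl, (by decide : Even 4).pow_abs]
    rw [this, hx2]; ring
  rw [hx4, hx2] at hcos
  have e : ((d * (Real.cos (φ / s / 2) - 1) : ℝ) : ℂ) - (-(φ : ℂ) ^ 2 / 8) =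
      ((d * (Real.cos (φ / s / 2) - (1 - φ ^ 2 / d / 4 / 2)) : ℝ) : ℂ) := by
    have : (d : ℂ) ≠ 0 := by exact_mod_cast hd'.ne'
    push_cast
    field_simp
    ring
  rw [e, Complex.norm_real, norm_mul, Real.norm_of_nonneg hd'.le, Real.norm_eq_abs,
    Real.norm_of_nonneg (by positivity)]
  refine (mul_le_mul_of_nonneg_left hcos hd'.le).trans ?_
  have h4 : 0 ≤ φ ^ 4 := by positivity
  rw [mul_one_div, le_div_iff₀ hd']
  have : d * (φ ^ 4 / (d : ℝ) ^ 2 / 16 * (5 / 96)) * d = φ ^ 4 * (5 / 1536) := by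
    field_simp; ring
  rw [this]
  linarith

lemma isBigO_sin_sub (φ : ℝ) : (fun d : ℕ => -Complex.I / 2 *
      ((Real.sqrt d * Real.sin (φ / Real.sqrt d / 2) : ℝ) : ℂ) - (-Complex.I * φ / 4)) =O[atTop]
    fun d : ℕ => 1 / (d : ℝ) := by
  -- A cubic remainder times `√d` is of order `1 / d`; the constant obtained below is `|φ| ^ 3 /
  -- 16`.
  refine Asymptotics.IsBigO.of_bound (|φ| ^ 3) ?_
  filter_upwards [eventually_ge_atTop 1, tendsto_natCast_atTop_atTop.eventually_ge_atTop (φ ^ 2)]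
    with d hd hdφ
  have hd' : (0 : ℝ) < d := by exact_mod_cast hd
  set s := Real.sqrt d with hs
  have hs0 : 0 < s := Real.sqrt_pos.2 hd'
  have hs2 : s ^ 2 = d := Real.sq_sqrt hd'.le
  set x := φ / s / 2 with hxdef
  have hx2 : x ^ 2 = φ ^ 2 / d / 4 := by rw [hxdef, div_pow, div_pow, hs2]; ring
  have hx : |x| ≤ 1 := by
    rw [← sq_le_one_iff_abs_le_one, hx2]
    have : φ ^ 2 / d ≤ 1 := by rwa [div_le_one hd']
    linarith
  have hsin : |Real.sin x - x| ≤ |x| ^ 3 := by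
    have h1 := Real.sin_bound hx
    have h2 : |x| ^ 5 ≤ |x| ^ 3 := pow_le_pow_of_le_one (abs_nonneg x) hx (by norm_num)
    have h3 : |x ^ 3 / 6| = |x| ^ 3 / 6 := by rw [abs_div, abs_pow]; norm_num
    have h4 : Real.sin x - x = (Real.sin x - (x - x ^ 3 / 6)) - x ^ 3 / 6 := by ring
    have h5 : 0 ≤ |x| ^ 3 := by positivity
    rw [h4]
    refine (abs_sub _ _).trans ?_
    rw [h3]
    linarith
  have e : -Complex.I / 2 * ((s * Real.sin x : ℝ) : ℂ) - (-Complex.I * φ / 4) =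
      -Complex.I / 2 * ((s * (Real.sin x - x) : ℝ) : ℂ) := by
    have : (φ : ℂ) = ((2 * s * x : ℝ) : ℂ) := by
      congr 1
      rw [hxdef]
      field_simp
    rw [this]
    push_cast
    ring
  rw [e, norm_mul, norm_div, norm_neg, Complex.norm_I, Complex.norm_two, Complex.norm_real,
    norm_mul, Real.norm_of_nonneg hs0.le, Real.norm_eq_abs, Real.norm_of_nonneg (by positivity)]
  have h1 : 1 / 2 * (s * |Real.sin x - x|) ≤ 1 / 2 * (s * |x| ^ 3) := by gcongr
  refine h1.trans ?_
  have habs : |x| = |φ| / s / 2 := by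
    rw [hxdef, abs_div, abs_div, abs_of_pos hs0]; norm_num
  have h3 : 0 ≤ |φ| ^ 3 := by positivity
  rw [mul_one_div, le_div_iff₀ hd', ← hs2, habs]
  have : 1 / 2 * (s * (|φ| / s / 2) ^ 3) * s ^ 2 = |φ| ^ 3 / 16 := by
    field_simp; ring
  rw [this]
  linarith

/-- After rescaling, the Erdős–Rényi limit approaches that of the Sherrington–Kirkpatrick model. -/
lemma isBigO_limitEnergy (β γ : Fin p → ℝ) :
    (fun d : ℕ => limitEnergy β
        (fun a b => ((d * (Real.cos (phase γ a b / Real.sqrt d / 2) - 1) : ℝ) : ℂ))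
        (fun a b => -Complex.I / 2 *
          ((Real.sqrt d * Real.sin (phase γ a b / Real.sqrt d / 2) : ℝ) : ℂ)) -
      limitEnergy β (fun a b => -(phase γ a b : ℂ) ^ 2 / 8)
        (fun a b => -Complex.I * phase γ a b / 4)) =O[atTop] fun d : ℕ => 1 / (d : ℝ) := by
  set X : ℕ → (History p → History p → ℂ) × (History p → History p → ℂ) := fun d =>
    (fun a b => ((d * (Real.cos (phase γ a b / Real.sqrt d / 2) - 1) : ℝ) : ℂ),
      fun a b => -Complex.I / 2 *
          ((Real.sqrt d * Real.sin (phase γ a b / Real.sqrt d / 2) : ℝ) : ℂ)) with hX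
  set x₀ : (History p → History p → ℂ) × (History p → History p → ℂ) :=
    (fun a b => -(phase γ a b : ℂ) ^ 2 / 8, fun a b => -Complex.I * phase γ a b / 4) with hx₀
  have hO : (fun d => X d - x₀) =O[atTop] fun d : ℕ => 1 / (d : ℝ) := by
    refine Asymptotics.IsBigO.prod_left ?_ ?_
    · exact Asymptotics.isBigO_pi.2 fun a => Asymptotics.isBigO_pi.2 fun b => isBigO_cos_sub _
    · exact Asymptotics.isBigO_pi.2 fun a => Asymptotics.isBigO_pi.2 fun b => isBigO_sin_sub _
  have hlim : Tendsto X atTop (𝓝 x₀) :=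
    tendsto_sub_nhds_zero_iff.1 (hO.trans_tendsto tendsto_one_div_atTop_nhds_zero_nat)
  -- Differentiability at `x₀` bounds the increment of the energy by that of its arguments.
  exact (((differentiable_limitEnergy β) x₀).isBigO_sub.comp_tendsto hlim).trans hO

end QAOA

end

/-! ### Comparison of the energies for every `d` -/

theorem theorem2 (p : ℕ) (hp : 1 ≤ p) (β γ : Fin p → ℝ) :
    ∃ (eSK : ℝ) (eER : ℕ → ℝ),
      Tendsto (fun n : ℕ => (∫ J, QAOA.energy J β γ ∂(QAOA.skLaw n)) / (n : ℝ))
        atTop (𝓝 eSK) ∧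
      (∀ d : ℕ, 3 ≤ d →
        Tendsto (fun n : ℕ =>
            (∫ J, QAOA.energy J β (fun j => γ j / Real.sqrt (d : ℝ))
              ∂(QAOA.erLaw n ((d : ℝ) / ((n : ℝ) - 1)))) / ((n : ℝ) * (d : ℝ)))
          atTop (𝓝 (eER d))) ∧
      ∃ C : ℝ, ∀ d : ℕ, 3 ≤ d →
        |eER d - 1 / Real.sqrt (d : ℝ) * eSK| ≤ C * (1 / (d : ℝ)) := by
  refine ⟨_, _, QAOA.tendsto_energy_sk β γ, fun d hd => QAOA.tendsto_energy_er β
    (fun j => γ j / Real.sqrt d) d (by exact_mod_cast (by omega : 0 < d)), ?_⟩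
  -- The asymptotic bound extends to every `d` at which `1 / d` is nonzero, since only finitely many
  -- `d` have to be absorbed into `C`.
  obtain ⟨C, hC, hbound⟩ := Asymptotics.bound_of_isBigO_nat_atTop (QAOA.isBigO_limitEnergy β γ)
  refine ⟨C, fun d hd => ?_⟩
  have hd' : (0 : ℝ) < d := by exact_mod_cast (by omega : 0 < d)
  have hs1 : 1 ≤ Real.sqrt d := Real.one_le_sqrt.2 (by exact_mod_cast (by omega : 1 ≤ d))
  have hs0 : 0 < Real.sqrt d := by linarith
  have h1 := hbound (x := d) (one_div_ne_zero hd'.ne')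
  rw [← QAOA.limitEnergy_er β γ d, Real.norm_of_nonneg (by positivity)] at h1
  refine le_trans ?_ h1
  set E := QAOA.limitEnergy β
        (fun a b => ((d : ℝ) : ℂ) * (Complex.exp (-Complex.I *
          ((QAOA.phase (fun j => γ j / Real.sqrt d) a b / 2 : ℝ) : ℂ)) - 1))
        (fun a b => Complex.exp (-Complex.I *
          ((QAOA.phase (fun j => γ j / Real.sqrt d) a b / 2 : ℝ) : ℂ)) / 2)
  set F := QAOA.limitEnergy β (fun a b => -(QAOA.phase γ a b : ℂ) ^ 2 / 8)
        (fun a b => -Complex.I * QAOA.phase γ a b / 4)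
  have h2 : Real.sqrt d * (E.re - 1 / Real.sqrt d * F.re) = (Real.sqrt d * E - F).re := by
    rw [Complex.sub_re, Complex.re_ofReal_mul]
    field_simp
  calc |E.re - 1 / Real.sqrt d * F.re|
      -- The difference multiplied by `√d` is already at most `C / d`, so a factor `√d` is given
      -- away here.
      ≤ Real.sqrt d * |E.re - 1 / Real.sqrt d * F.re| := le_mul_of_one_le_left (abs_nonneg _) hs1
    _ = |(Real.sqrt d * E - F).re| := by rw [← h2, abs_mul, abs_of_pos hs0]
    _ ≤ _ := Complex.abs_re_le_norm _
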